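/- Fix a countably infinite set $\mathbb A$ of names, let $\mathrm{Perm}\,\mathbb A$ be the group of finite permutations of $\mathbb A$ (those moving only finitely many names), and let $k\in\mathbb N$. A set $S\subseteq\mathbb A$ supports an element $x$ of a $\mathrm{Perm}\,\mathbb A$-set if every $\pi\in\mathrm{Perm}\,\mathbb A$ fixing $S$ pointwise satisfies $\pi\cdot x=x$. A nominal set is a $\mathrm{Perm}\,\mathbb A$-set all of whose elements have a finite support; $\mathbf{Nom}$ is the category of nominal sets and equivariant maps. A subset $Y$ of a nominal set is finitely supported if it has a finite support under $\pi\cdot Y=\{\pi\cdot y\mid y\in Y\}$, and orbit-finite if it is finitely supported and meets only finitely many orbits. A nominal boolean algebra is a nominal set with a boolean algebra structure whose operations are equivariant. It is complete (orbit-finitely complete) if every finitely supported (every orbit-finite) subset has a supremum; morphisms of complete (orbit-finitely complete) nominal boolean algebras are equivariant boolean homomorphisms preserving suprema of finitely supported (orbit-finite) subsets. A subalgebra of an orbit-finitely complete nominal boolean algebra is an equivariant subset closed under the boolean operations and under suprema of orbit-finite subsets. A nominal boolean algebra is $k$-atomic if every element is the supremum of the atoms below it, there are only finitely many orbits of atoms,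 and every atom has a support with at most $k$ elements. An orbit-finitely complete nominal boolean algebra is locally $k$-atomic if each of its elements lies in a $k$-atomic subalgebra. Let $\mathcal A_k$ be the category of $k$-atomic complete nominal boolean algebras and $\mathcal L_k$ the category of locally $k$-atomic orbit-finitely complete nominal boolean algebras (full subcategories of the categories of complete, respectively orbit-finitely complete, nominal boolean algebras). Theorem. The inclusion $E\colon\mathcal A_k\to\mathcal L_k$ exhibits $\mathcal L_k$ as the Ind-completion of $\mathcal A_k$, i.e. as its free completion under directed colimits, so $\mathcal L_k\simeq\mathrm{Ind}(\mathcal A_k)$. Explicitly: $E$ is a full embedding; $\mathcal L_k$ has directed colimits (colimits of small diagrams indexed by nonempty directed preorders); for every category $\mathcal T$ with directed colimits, every functor $F\colon\mathcal A_k\to\mathcal T$ has an extension $\overline F\colon\mathcal L_k\to\mathcal T$ that preserves directed colimits and satisfies $\overline F\circ E=F$; and for any two such extensions $G,H$ of $F$ there is a natural isomorphism $\alpha\colon G\cong H$ with $\alpha E=\mathrm{id}_F$. Moreover: (a) directed colimits in $\mathcal L_k$ are formed in $\mathbf{Nom}$: the forgetful functor $\mathcal L_k\to\mathbf{Nom}$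 creates and preserves them; (b) for every $A\in\mathcal A_k$ the object $EA$ is finitely presentable in $\mathcal L_k$, i.e. $\mathcal L_k(EA,-)$ preserves directed colimits; (c) every $B\in\mathcal L_k$ is the directed union of its $k$-atomic subalgebras: these form a nonempty family, any two of them are contained in a third, and their union is $B$. -/

import Mathlib

open CategoryTheory CategoryTheory.Limits
open scoped Pointwise

universe a u w v₁ u₁ v₂ u₂ v₃ u₃

namespace NomBA

section NominalSets

/-- The group of finite permutations of the set `𝔸` of names. -/
def FinPerm (𝔸 : Type a) : Subgroup (Equiv.Perm 𝔸) where
  carrier := {π | {x | π x ≠ x}.Finite}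
  one_mem' := by simp
  mul_mem' {π σ} hπ hσ := by
    refine (Set.Finite.union hπ hσ).subset fun x hx => ?_
    by_contra h
    simp only [Set.mem_union, Set.mem_ofPred_eq, not_or, not_not] at h
    exact hx (by simp [h.1, h.2])
  inv_mem' {π} hπ := by
    refine Set.Finite.subset hπ fun x hx h => hx ?_
    exact Equiv.Perm.inv_eq_iff_eq.2 h.symm

variable (𝔸 : Type a)

/-- `x` has a finite support: some finite set `S` of names such that every finite permutation
fixing all elements of `S` fixes `x`. For subsets the action is `π • U = {π • x | x ∈ U}`. -/
def FinSupp {X : Type*} [MulAction (FinPerm 𝔸) X] (x : X) : Prop :=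
  ∃ S : Finset 𝔸, MulAction.Supports (FinPerm 𝔸) (S : Set 𝔸) x

/-- The least finite support of `x` has at most `k` elements, i.e. `x` has some support with at
most `k` elements. -/
def SuppBdd (k : ℕ) {X : Type*} [MulAction (FinPerm 𝔸) X] (x : X) : Prop :=
  ∃ S : Finset 𝔸, S.card ≤ k ∧ MulAction.Supports (FinPerm 𝔸) (S : Set 𝔸) x

/-- The subset `Y` meets only finitely many orbits. -/
def MeetsFinitelyManyOrbits {X : Type*} [MulAction (FinPerm 𝔸) X] (Y : Set X) : Prop :=
  (MulAction.orbit (FinPerm 𝔸) '' Y).Finite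

/-- Orbit-finite subsets: finitely supported subsets meeting only finitely many orbits. -/
def OrbitFinite {X : Type*} [MulAction (FinPerm 𝔸) X] (Y : Set X) : Prop :=
  FinSupp 𝔸 Y ∧ MeetsFinitelyManyOrbits 𝔸 Y

/-- Nominal sets over the set `𝔸` of names. -/
structure Nom : Type (max a (u + 1)) where
  carrier : Type u
  [act : MulAction (FinPerm 𝔸) carrier]
  finSupp : ∀ x : carrier, FinSupp 𝔸 x

attribute [instance] Nom.act

/-- The category of nominal sets and equivariant maps. -/
instance : Category.{u} (Nom.{a, u} 𝔸) where
  Hom X Y := X.carrier →[FinPerm 𝔸] Y.carrier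
  id X := MulActionHom.id _
  comp f g := g.comp f

end NominalSets

section NominalBooleanAlgebras

variable (𝔸 : Type a)

/-- `B` is a nominal boolean algebra: every element is finitely supported, and all boolean
operations are equivariant. -/
structure IsNominalBA (B : Type*) [BooleanAlgebra B] [MulAction (FinPerm 𝔸) B] : Prop where
  finSupp : ∀ x : B, FinSupp 𝔸 x
  smul_sup : ∀ (π : FinPerm 𝔸) (x y : B), π • (x ⊔ y) = π • x ⊔ π • y
  smul_inf : ∀ (π : FinPerm 𝔸) (x y : B), π • (x ⊓ y) = π • x ⊓ π • y
  smul_compl : ∀ (π : FinPerm 𝔸) (x : B), π • xᶜ = (π • x)ᶜ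
  smul_top : ∀ π : FinPerm 𝔸, π • (⊤ : B) = ⊤
  smul_bot : ∀ π : FinPerm 𝔸, π • (⊥ : B) = ⊥

/-- Every finitely supported subset has a supremum. -/
def IsComplete (B : Type*) [BooleanAlgebra B] [MulAction (FinPerm 𝔸) B] : Prop :=
  ∀ X : Set B, FinSupp 𝔸 X → ∃ s, IsLUB X s

/-- Every orbit-finite (finitely supported) subset has a supremum. -/
def IsOFComplete (B : Type*) [BooleanAlgebra B] [MulAction (FinPerm 𝔸) B] : Prop :=
  ∀ X : Set B, OrbitFinite 𝔸 X → ∃ s, IsLUB X s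

/-- `k`-atomic: every element is the supremum of all atoms below it, and the (equivariant) set of
atoms is a `k`-bounded orbit-finite nominal set. -/
structure IsKAtomic (k : ℕ) (B : Type*) [BooleanAlgebra B] [MulAction (FinPerm 𝔸) B] :
    Prop where
  isLUB_atoms : ∀ x : B, IsLUB {b | IsAtom b ∧ b ≤ x} x
  atoms_orbits : MeetsFinitelyManyOrbits 𝔸 {b : B | IsAtom b}
  atoms_bdd : ∀ b : B, IsAtom b → SuppBdd 𝔸 k b

/-- Subalgebras of an orbit-finitely complete nominal boolean algebra: equivariant subsets closed
under the boolean operations and under suprema of orbit-finite subsets. -/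
structure Subalg (B : Type*) [BooleanAlgebra B] [MulAction (FinPerm 𝔸) B] extends
    BooleanSubalgebra B where
  smul_mem' : ∀ (π : FinPerm 𝔸) {x : B}, x ∈ carrier → π • x ∈ carrier
  isLUB_mem' : ∀ {X : Set B} {s : B}, X ⊆ carrier → OrbitFinite 𝔸 X → IsLUB X s → s ∈ carrier

/-- A subalgebra carries the restricted action. (Its boolean algebra structure is the
restricted one, as provided by `BooleanSubalgebra`.) -/
instance {B : Type*} [BooleanAlgebra B] [MulAction (FinPerm 𝔸) B] (A : Subalg 𝔸 B) :
    MulAction (FinPerm 𝔸) A.toBooleanSubalgebra where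
  smul π x := ⟨π • x.1, A.smul_mem' π x.2⟩
  one_smul x := Subtype.ext (one_smul _ x.1)
  mul_smul π σ x := Subtype.ext (mul_smul π σ x.1)

/-- Locally `k`-atomic: every element lies in a `k`-atomic subalgebra. -/
def IsLocallyKAtomic (k : ℕ) (B : Type*) [BooleanAlgebra B] [MulAction (FinPerm 𝔸) B] : Prop :=
  ∀ x : B, ∃ A : Subalg 𝔸 B, IsKAtomic 𝔸 k A.toBooleanSubalgebra ∧ x ∈ A.carrier

/-- Complete nominal boolean algebras. -/
structure CBA : Type (max a (u + 1)) where
  carrier : Type u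
  [ba : BooleanAlgebra carrier]
  [act : MulAction (FinPerm 𝔸) carrier]
  nominal : IsNominalBA 𝔸 carrier
  complete : IsComplete 𝔸 carrier

/-- Orbit-finitely complete nominal boolean algebras. -/
structure OFCBA : Type (max a (u + 1)) where
  carrier : Type u
  [ba : BooleanAlgebra carrier]
  [act : MulAction (FinPerm 𝔸) carrier]
  nominal : IsNominalBA 𝔸 carrier
  ofComplete : IsOFComplete 𝔸 carrier

attribute [instance] CBA.ba CBA.act OFCBA.ba OFCBA.act

/-- Equivariant boolean homomorphisms preserving the suprema of all finitely supported subsets. -/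
@[ext]
structure CHom (B C : Type*) [BooleanAlgebra B] [BooleanAlgebra C]
    [MulAction (FinPerm 𝔸) B] [MulAction (FinPerm 𝔸) C] where
  hom : BoundedLatticeHom B C
  map_smul : ∀ (π : FinPerm 𝔸) (x : B), hom (π • x) = π • hom x
  map_isLUB : ∀ (X : Set B) (s : B), FinSupp 𝔸 X → IsLUB X s → IsLUB (hom '' X) (hom s)

/-- Equivariant boolean homomorphisms preserving the suprema of orbit-finite subsets. -/
@[ext]
structure OFCHom (B C : Type*) [BooleanAlgebra B] [BooleanAlgebra C]
    [MulAction (FinPerm 𝔸) B] [MulAction (FinPerm 𝔸) C] where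
  hom : BoundedLatticeHom B C
  map_smul : ∀ (π : FinPerm 𝔸) (x : B), hom (π • x) = π • hom x
  map_isLUB : ∀ (X : Set B) (s : B), OrbitFinite 𝔸 X → IsLUB X s → IsLUB (hom '' X) (hom s)

variable {𝔸}

lemma FinSupp.image {B C : Type*} [MulAction (FinPerm 𝔸) B] [MulAction (FinPerm 𝔸) C]
    (f : B → C) (hf : ∀ (π : FinPerm 𝔸) (x : B), f (π • x) = π • f x) {X : Set B}
    (hX : FinSupp 𝔸 X) : FinSupp 𝔸 (f '' X) := by
  obtain ⟨S, hS⟩ := hX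
  refine ⟨S, fun π hπ => ?_⟩
  conv_rhs => rw [← hS π hπ]
  ext y
  simp only [Set.mem_smul_set, Set.mem_image]
  constructor
  · rintro ⟨_, ⟨x, hx, rfl⟩, rfl⟩
    exact ⟨π • x, ⟨x, hx, rfl⟩, hf π x⟩
  · rintro ⟨_, ⟨x, hx, rfl⟩, rfl⟩
    exact ⟨f x, ⟨x, hx, rfl⟩, (hf π x).symm⟩

lemma OrbitFinite.image {B C : Type*} [MulAction (FinPerm 𝔸) B] [MulAction (FinPerm 𝔸) C]
    (f : B → C) (hf : ∀ (π : FinPerm 𝔸) (x : B), f (π • x) = π • f x) {X : Set B}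
    (hX : OrbitFinite 𝔸 X) : OrbitFinite 𝔸 (f '' X) := by
  refine ⟨hX.1.image f hf, (hX.2.image (fun O => f '' O)).subset ?_⟩
  rintro _ ⟨_, ⟨x, hx, rfl⟩, rfl⟩
  refine ⟨_, ⟨x, hx, rfl⟩, ?_⟩
  ext y
  simp only [MulAction.orbit, Set.mem_image, Set.mem_range]
  constructor
  · rintro ⟨_, ⟨π, rfl⟩, rfl⟩
    exact ⟨π, (hf π x).symm⟩
  · rintro ⟨π, rfl⟩
    exact ⟨_, ⟨π, rfl⟩, hf π x⟩

variable (𝔸)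

instance : Category.{u} (CBA.{a, u} 𝔸) where
  Hom B C := CHom 𝔸 B.carrier C.carrier
  id B := ⟨BoundedLatticeHom.id _, fun _ _ => rfl, fun X s _ h => by simpa using h⟩
  comp f g := ⟨g.hom.comp f.hom,
    fun π x => by simp [f.map_smul, g.map_smul],
    fun X s hX h => by
      have := g.map_isLUB _ _ (hX.image f.hom f.map_smul) (f.map_isLUB X s hX h)
      simpa [Set.image_image] using this⟩

instance : Category.{u} (OFCBA.{a, u} 𝔸) where
  Hom B C := OFCHom 𝔸 B.carrier C.carrier
  id B := ⟨BoundedLatticeHom.id _, fun _ _ => rfl, fun X s _ h => by simpa using h⟩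
  comp f g := ⟨g.hom.comp f.hom,
    fun π x => by simp [f.map_smul, g.map_smul],
    fun X s hX h => by
      have := g.map_isLUB _ _ (hX.image f.hom f.map_smul) (f.map_isLUB X s hX h)
      simpa [Set.image_image] using this⟩

/-- The full subcategory of `k`-atomic complete nominal boolean algebras. -/
abbrev KAtomicCBA (k : ℕ) : Type (max a (u + 1)) :=
  ObjectProperty.FullSubcategory (fun B : CBA.{a, u} 𝔸 => IsKAtomic 𝔸 k B.carrier)

/-- The full subcategory of locally `k`-atomic orbit-finitely complete nominal boolean
algebras. -/
abbrev LocKAtomicOFCBA (k : ℕ) : Type (max a (u + 1)) :=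
  ObjectProperty.FullSubcategory (fun B : OFCBA.{a, u} 𝔸 => IsLocallyKAtomic 𝔸 k B.carrier)

variable {𝔸}

/-- The improper subalgebra. -/
def Subalg.univ (B : Type*) [BooleanAlgebra B] [MulAction (FinPerm 𝔸) B] : Subalg 𝔸 B where
  toBooleanSubalgebra := ⊤
  smul_mem' _ _ _ := Set.mem_univ _
  isLUB_mem' _ _ _ := Set.mem_univ _

lemma IsKAtomic.univ {k : ℕ} {B : Type*} [BooleanAlgebra B] [MulAction (FinPerm 𝔸) B]
    (h : IsKAtomic 𝔸 k B) :
    IsKAtomic 𝔸 k (Subalg.univ (𝔸 := 𝔸) B).toBooleanSubalgebra := by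
  let e : (Subalg.univ (𝔸 := 𝔸) B).toBooleanSubalgebra ≃o B :=
    { toFun := Subtype.val
      invFun := fun x => ⟨x, Set.mem_univ x⟩
      left_inv := fun _ => rfl
      right_inv := fun _ => rfl
      map_rel_iff' := Iff.rfl }
  have he : ∀ (π : FinPerm 𝔸) (x : B), e.symm (π • x) = π • e.symm x := fun _ _ => rfl
  refine ⟨fun x => ?_, ?_, fun b hb => ?_⟩
  · have := h.isLUB_atoms (e x)
    refine ⟨fun b hb => hb.2, fun y hy => ?_⟩
    refine this.2 (fun c hc => ?_)
    exact hy (a := e.symm c) ⟨(e.symm.isAtom_iff c).2 hc.1, hc.2⟩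
  · refine (h.atoms_orbits.image (fun O => e.symm '' O)).subset ?_
    rintro _ ⟨b, hb, rfl⟩
    refine ⟨_, ⟨e b, (e.isAtom_iff b).2 hb, rfl⟩, ?_⟩
    ext y
    simp only [MulAction.orbit, Set.mem_image, Set.mem_range]
    constructor
    · rintro ⟨_, ⟨π, rfl⟩, rfl⟩
      exact ⟨π, rfl⟩
    · rintro ⟨π, rfl⟩
      exact ⟨_, ⟨π, rfl⟩, rfl⟩
  · obtain ⟨S, hS, hb⟩ := h.atoms_bdd (e b) ((e.isAtom_iff b).2 hb)
    exact ⟨S, hS, fun π hπ => Subtype.ext (hb π hπ)⟩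

variable (𝔸)

/-- A `k`-atomic complete nominal boolean algebra is a locally `k`-atomic orbit-finitely complete
one, and the morphisms between complete algebras preserve in particular orbit-finite suprema. -/
def inclusion (k : ℕ) : KAtomicCBA.{a, u} 𝔸 k ⥤ LocKAtomicOFCBA.{a, u} 𝔸 k where
  obj B :=
    ⟨{ carrier := B.obj.carrier
       nominal := B.obj.nominal
       ofComplete := fun X hX => B.obj.complete X hX.1 },
     fun x => ⟨Subalg.univ B.obj.carrier, B.property.univ, Set.mem_univ x⟩⟩
  map f := ObjectProperty.homMk
    ({ hom := f.hom.hom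
       map_smul := f.hom.map_smul
       map_isLUB := fun X s hX h => f.hom.map_isLUB X s hX.1 h } :
      OFCHom 𝔸 _ _)

/-- The functor taking a locally `k`-atomic orbit-finitely complete nominal boolean algebra to its
underlying nominal set. -/
def forgetNom (k : ℕ) : LocKAtomicOFCBA.{a, u} 𝔸 k ⥤ Nom.{a, u} 𝔸 where
  obj B := { carrier := B.obj.carrier, finSupp := B.obj.nominal.finSupp }
  map {B C} f :=
    (⟨f.hom.hom, f.hom.map_smul⟩ : B.obj.carrier →[FinPerm 𝔸] C.obj.carrier)

end NominalBooleanAlgebras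

section IndCompletion

variable {C : Type u₁} [Category.{v₁} C] {D : Type u₂} [Category.{v₂} D]

/-- `C` has colimits of all diagrams indexed by (`w`-small, nonempty) directed preorders. -/
def HasDirectedColimits (C : Type u₁) [Category.{v₁} C] : Prop :=
  ∀ (J : Type w) [Preorder J] [IsDirectedOrder J] [Nonempty J], HasColimitsOfShape J C

/-- `F` preserves colimits of diagrams indexed by directed preorders. -/
def PreservesDirectedColimits (F : C ⥤ D) : Prop :=
  ∀ (J : Type w) [Preorder J] [IsDirectedOrder J] [Nonempty J], PreservesColimitsOfShape J F

/-- `F` creates colimits of diagrams indexed by directed preorders. -/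
def CreatesDirectedColimits (F : C ⥤ D) : Prop :=
  ∀ (J : Type w) [Preorder J] [IsDirectedOrder J] [Nonempty J],
    Nonempty (CreatesColimitsOfShape J F)

/-- `X` is finitely presentable: `C(X, -)` preserves directed colimits. -/
def IsFinPresentable (X : C) : Prop :=
  PreservesDirectedColimits.{w} (coyoneda.obj (Opposite.op X))

/-- The functor `E : C ⥤ D` exhibits `D` as the Ind-completion of `C`, i.e. as its free completion
under directed colimits: `E` is a full embedding, `D` has directed colimits, and every functor from
`C` to a category `T` with directed colimits extends along `E` to a functor preserving directed
colimits, which is essentially unique. -/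
structure IsIndCompletion (E : C ⥤ D) : Prop where
  full : E.Full
  faithful : E.Faithful
  injective_obj : Function.Injective E.obj
  hasDirectedColimits : HasDirectedColimits.{w} D
  exists_extension : ∀ {T : Type u₃} [Category.{v₃} T], HasDirectedColimits.{w} T →
    ∀ F : C ⥤ T, ∃ F' : D ⥤ T, PreservesDirectedColimits.{w} F' ∧ E ⋙ F' = F
  extension_unique : ∀ {T : Type u₃} [Category.{v₃} T], HasDirectedColimits.{w} T →
    ∀ (F : C ⥤ T) (G H : D ⥤ T), PreservesDirectedColimits.{w} G →
      PreservesDirectedColimits.{w} H → ∀ (hG : E ⋙ G = F) (hH : E ⋙ H = F),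
        ∃ α : G ≅ H, Functor.isoWhiskerLeft E α = eqToIso (hG.trans hH.symm)

end IndCompletion

end NomBA

/-!
A `k`-atomic algebra `A` is determined by its orbit-finite nominal set of atoms, and a homomorphism
out of it is the same thing as an equivariant map sending the atoms to a partition of unity
(`IsKAtomic.exists_hom_extending`, `OFCHom.eq_of_eqOn_atoms`). Everything rests on one finiteness
fact about names: the product of two orbit-finite nominal sets is orbit-finite
(`MeetsFinitelyManyOrbits.prod`). Consequently, a property that each element of an orbit-finite set
acquires at some stage of a directed diagram is acquired by all of them at a single stage
(`MeetsFinitelyManyOrbits.exists_uniform`).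

*Full embedding.* A finitely supported set in a `k`-atomic algebra has the same upper bounds as the
orbit-finite set of atoms below its elements, so preserving orbit-finite suprema already means
preserving all finitely supported ones (`OFCHom.map_isLUB_of_finSupp`).

*Directed colimits.* On the directed union of the underlying sets, the coprojections preserve
orbit-finite suprema by the uniformity principle, and every orbit-finite subset comes from one
stage; so the union is an orbit-finitely complete algebra and a colimit both of algebras and of
nominal sets (`ColimCarrier.isLUB_mk`, `IsDirectedUnion.nonempty_isColimit`).

*Directed unions of `k`-atomic subalgebras.* The common refinement of the atoms of two `k`-atomic
subalgebras is an orbit-finite partition of unity whose blocks a priori have supports of size `2k`.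
In a locally `k`-atomic algebra every nonzero block of an equivariant partition lies above an atom
`q` of some `k`-atomic subalgebra, and the block is supported by every support of `q`; hence the
refinement consists of the atoms of a `k`-atomic subalgebra (`IsPartition.suppBdd`,
`IsPartition.isKAtomic_ofBlocks`).

*Finite presentability.* A homomorphism from a `k`-atomic algebra into a directed union amounts to a
partition of unity indexed by its atoms. Lifting the elements, their equivariance, their
disjointness and the fact that their supremum is `⊤` are orbit-finitely many conditions, all met at
some stage (`IsDirectedUnion.exists_lift`).

*Universal property.* If `E` is a full embedding with finitely presentable values and each object
`B` is a directed colimit of `E`-objects, that diagram is final among the `E`-objects over `B`.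
So pointwise left Kan extensions along `E` exist, they preserve directed colimits, and every functor
preserving directed colimits is the left Kan extension of its restriction
(`isIndCompletion_of_finPresentable`).
-/

namespace NomBA

/-! ### Orbit-finite sets -/

section OrbitFiniteSets

variable {𝔸 : Type a}

lemma exists_finPerm_eqOn (A : Finset 𝔸) (g : 𝔸 → 𝔸) (hg : Set.InjOn g A) :
    ∃ τ : FinPerm 𝔸, ∀ x ∈ A, τ • x = g x := by
  classical
  let U : Finset 𝔸 := A ∪ A.image g
  obtain ⟨e, he⟩ := Set.MapsTo.exists_equiv_extend_of_card_eq (α := U) (t := U) (by simp)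
    (s := {x | (x : 𝔸) ∈ A}) (f := fun x => g x)
    (fun x hx => by exact Finset.mem_union_right _ (Finset.mem_image_of_mem g hx))
    (fun x hx y hy h => Subtype.ext (hg hx hy h))
  refine ⟨⟨Equiv.Perm.ofSubtype e, ?_⟩, fun x hx => ?_⟩
  · refine U.finite_toSet.subset fun x hx => ?_
    by_contra h
    exact hx (Equiv.Perm.ofSubtype_apply_of_not_mem e h)
  · have hxU : x ∈ U := Finset.mem_union_left _ hx
    exact (Equiv.Perm.ofSubtype_apply_of_mem e hxU).trans (he ⟨x, hxU⟩ hx)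

/-- If two finite permutations `σ`, `σ'` hit the names of `S` in the same way when restricted to
`T`, then `σ'` agrees on `T` with `τ * σ` for some `τ` that fixes `S` pointwise. -/
lemma exists_finPerm_fixing_mul_eqOn (S T : Finset 𝔸) (σ σ' : FinPerm 𝔸)
    (h : ∀ t ∈ T, ∀ s ∈ S, σ • t = s ↔ σ' • t = s) :
    ∃ τ : FinPerm 𝔸, (∀ s ∈ S, τ • s = s) ∧ ∀ t ∈ T, τ • σ • t = σ' • t := by
  classical
  have key : ∀ x, x ∉ S → x ∈ T.image (σ • ·) → σ' • σ⁻¹ • x ∉ S := by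
    intro x hxS hxT hx
    obtain ⟨t, ht, rfl⟩ := Finset.mem_image.1 hxT
    rw [inv_smul_smul] at hx
    exact hxS ((h t ht _ hx).2 rfl ▸ hx)
  obtain ⟨τ, hτ⟩ := exists_finPerm_eqOn (S ∪ T.image (σ • ·))
    (fun x => if x ∈ S then x else σ' • σ⁻¹ • x) (by
      intro x hx y hy hxy
      simp only [Finset.coe_union, Set.mem_union, Finset.mem_coe] at hx hy
      by_cases hxS : x ∈ S <;> by_cases hyS : y ∈ S <;> simp only [hxS, hyS, if_true, if_false]
        at hxy
      · exact hxy
      · exact absurd (hxy ▸ hxS) (key y hyS (hy.resolve_left hyS))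
      · exact absurd (hxy ▸ hyS) (key x hxS (hx.resolve_left hxS))
      · simpa using hxy)
  refine ⟨τ, fun s hs => ?_, fun t ht => ?_⟩
  · rw [hτ s (Finset.mem_union_left _ hs), if_pos hs]
  · rw [hτ _ (Finset.mem_union_right _ (Finset.mem_image_of_mem _ ht))]
    split_ifs with hS
    · exact ((h t ht _ hS).1 rfl).symm
    · rw [inv_smul_smul]

variable {X Y : Type*} [MulAction (FinPerm 𝔸) X] [MulAction (FinPerm 𝔸) Y]

lemma MeetsFinitelyManyOrbits.exists_finite {s : Set X} (hs : MeetsFinitelyManyOrbits 𝔸 s) :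
    ∃ r ⊆ s, r.Finite ∧ ∀ x ∈ s, ∃ y ∈ r, ∃ π : FinPerm 𝔸, π • y = x := by
  obtain ⟨r, hrs, h⟩ := Set.exists_subset_bijOn s (MulAction.orbit (FinPerm 𝔸))
  refine ⟨r, hrs, Set.Finite.of_finite_image (h.image_eq ▸ hs) h.injOn, fun x hx => ?_⟩
  obtain ⟨y, hy, hyx⟩ := h.surjOn ⟨x, hx, rfl⟩
  exact ⟨y, hy, (hyx ▸ MulAction.mem_orbit_self x : x ∈ MulAction.orbit (FinPerm 𝔸) y)⟩

lemma MeetsFinitelyManyOrbits.mono {s t : Set X} (ht : MeetsFinitelyManyOrbits 𝔸 t)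
    (h : s ⊆ t) : MeetsFinitelyManyOrbits 𝔸 s :=
  Set.Finite.subset ht (Set.image_mono h)

lemma MeetsFinitelyManyOrbits.of_finite {r s : Set X} (hr : r.Finite)
    (h : ∀ x ∈ s, ∃ y ∈ r, ∃ π : FinPerm 𝔸, π • y = x) : MeetsFinitelyManyOrbits 𝔸 s := by
  refine (hr.image (MulAction.orbit (FinPerm 𝔸))).subset ?_
  rintro _ ⟨x, hx, rfl⟩
  obtain ⟨y, hy, π, rfl⟩ := h x hx
  exact ⟨y, hy, (MulAction.orbit_smul π y).symm⟩

lemma MeetsFinitelyManyOrbits.image {s : Set X} (hs : MeetsFinitelyManyOrbits 𝔸 s) (f : X → Y)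
    (hf : ∀ (π : FinPerm 𝔸) (x : X), f (π • x) = π • f x) :
    MeetsFinitelyManyOrbits 𝔸 (f '' s) := by
  obtain ⟨r, -, hr, h⟩ := hs.exists_finite
  refine .of_finite (hr.image f) ?_
  rintro _ ⟨x, hx, rfl⟩
  obtain ⟨y, hy, π, rfl⟩ := h x hx
  exact ⟨f y, ⟨y, hy, rfl⟩, π, (hf π y).symm⟩

lemma MeetsFinitelyManyOrbits.singleton (x : X) : MeetsFinitelyManyOrbits 𝔸 {x} :=
  (Set.finite_singleton x).image _

/-- Up to simultaneous renaming there are only finitely many pairs formed from two orbits of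
finitely supported elements: the orbit of `(x, σ • y)` depends only on which names of a support of
`y` are sent by `σ` to which names of a support of `x`. -/
lemma finite_range_orbit_pair {x : X} {y : Y} (hx : FinSupp 𝔸 x) (hy : FinSupp 𝔸 y) :
    (Set.range fun σ : FinPerm 𝔸 => MulAction.orbit (FinPerm 𝔸) (x, σ • y)).Finite := by
  obtain ⟨S, hS⟩ := hx
  obtain ⟨T, hT⟩ := hy
  let data : FinPerm 𝔸 → T → S → Prop := fun σ t s => σ • (t : 𝔸) = s
  refine (Set.finite_range fun d =>
    MulAction.orbit (FinPerm 𝔸) (x, Function.invFun data d • y)).subset ?_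
  rintro _ ⟨σ, rfl⟩
  refine ⟨data σ, ?_⟩
  have hd : data (Function.invFun data (data σ)) = data σ := Function.invFun_eq ⟨σ, rfl⟩
  set σ' := Function.invFun data (data σ)
  obtain ⟨τ, hτS, hτT⟩ := exists_finPerm_fixing_mul_eqOn S T σ σ'
    fun t ht s hs => iff_of_eq (congrFun (congrFun hd.symm ⟨t, ht⟩) ⟨s, hs⟩)
  have h1 : τ • x = x := hS τ fun s hs => hτS s hs
  have h2 : τ • σ • y = σ' • y := by
    have : (σ'⁻¹ * τ * σ) • y = y := hT _ fun t ht => by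
      rw [mul_smul, mul_smul, hτT t ht, inv_smul_smul]
    rw [mul_smul, mul_smul, inv_smul_eq_iff] at this
    exact this
  calc MulAction.orbit (FinPerm 𝔸) (x, σ' • y)
      = MulAction.orbit (FinPerm 𝔸) (τ • (x, σ • y)) := by rw [Prod.smul_mk, h1, h2]
    _ = _ := MulAction.orbit_smul τ (x, σ • y)

lemma MeetsFinitelyManyOrbits.prod {s : Set X} {t : Set Y} (hs : MeetsFinitelyManyOrbits 𝔸 s)
    (ht : MeetsFinitelyManyOrbits 𝔸 t) (hs' : ∀ x ∈ s, FinSupp 𝔸 x) (ht' : ∀ y ∈ t, FinSupp 𝔸 y) :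
    MeetsFinitelyManyOrbits 𝔸 (s ×ˢ t) := by
  obtain ⟨r, hrs, hr, hr'⟩ := hs.exists_finite
  obtain ⟨q, hqt, hq, hq'⟩ := ht.exists_finite
  refine Set.Finite.subset (Set.Finite.biUnion hr fun x hx => Set.Finite.biUnion hq fun y hy =>
    finite_range_orbit_pair (hs' x (hrs hx)) (ht' y (hqt hy))) ?_
  rintro _ ⟨⟨x', y'⟩, ⟨hx, hy⟩, rfl⟩
  obtain ⟨x, hxr, π, rfl⟩ := hr' _ hx
  obtain ⟨y, hyq, σ, rfl⟩ := hq' _ hy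
  simp only [Set.mem_iUnion]
  refine ⟨x, hxr, y, hyq, π⁻¹ * σ, ?_⟩
  change MulAction.orbit (FinPerm 𝔸) (x, (π⁻¹ * σ) • y) = _
  rw [← MulAction.orbit_smul π, Prod.smul_mk, mul_smul, smul_inv_smul]

lemma MeetsFinitelyManyOrbits.image2 {Z : Type*} [MulAction (FinPerm 𝔸) Z] {s : Set X} {t : Set Y}
    (hs : MeetsFinitelyManyOrbits 𝔸 s) (ht : MeetsFinitelyManyOrbits 𝔸 t)
    (hs' : ∀ x ∈ s, FinSupp 𝔸 x) (ht' : ∀ y ∈ t, FinSupp 𝔸 y) (f : X → Y → Z)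
    (hf : ∀ (π : FinPerm 𝔸) (x : X) (y : Y), f (π • x) (π • y) = π • f x y) :
    MeetsFinitelyManyOrbits 𝔸 (Set.image2 f s t) := by
  rw [← Set.image_prod]
  exact (hs.prod ht hs' ht').image _ fun π p => hf π p.1 p.2

/-- In a directed family of equivariant predicates, a pointwise choice of indices on a set
meeting only finitely many orbits can be made uniformly. -/
lemma MeetsFinitelyManyOrbits.exists_uniform {J : Type*} [Preorder J] [IsDirectedOrder J]
    [Nonempty J] {s : Set X} (hs : MeetsFinitelyManyOrbits 𝔸 s) (P : J → X → Prop)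
    (hmono : ∀ ⦃i j x⦄, i ≤ j → P i x → P j x)
    (hsmul : ∀ i (π : FinPerm 𝔸) x, P i x → P i (π • x)) (h : ∀ x ∈ s, ∃ i, P i x) :
    ∃ i, ∀ x ∈ s, P i x := by
  obtain ⟨r, hrs, hr, hr'⟩ := hs.exists_finite
  choose! c hc using h
  obtain ⟨i, hi⟩ := (hr.image c).bddAbove
  refine ⟨i, fun x hx => ?_⟩
  obtain ⟨y, hy, π, rfl⟩ := hr' x hx
  exact hsmul i π y (hmono (hi ⟨y, hy, rfl⟩) (hc y (hrs hy)))

lemma FinSupp.map {x : X} (hx : FinSupp 𝔸 x) (f : X → Y)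
    (hf : ∀ (π : FinPerm 𝔸) (x : X), f (π • x) = π • f x) : FinSupp 𝔸 (f x) := by
  obtain ⟨S, hS⟩ := hx
  exact ⟨S, fun π hπ => by rw [← hf, hS π hπ]⟩

lemma SuppBdd.map {k : ℕ} {x : X} (hx : SuppBdd 𝔸 k x) (f : X → Y)
    (hf : ∀ (π : FinPerm 𝔸) (x : X), f (π • x) = π • f x) : SuppBdd 𝔸 k (f x) := by
  obtain ⟨S, hSk, hS⟩ := hx
  exact ⟨S, hSk, fun π hπ => by rw [← hf, hS π hπ]⟩

/-- Supports of a subset are recognised by one-sided invariance, the permutations fixing `S` being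
closed under inverses. -/
lemma supports_set_of_mem {s : Set X} {S : Set 𝔸}
    (h : ∀ π : FinPerm 𝔸, (∀ ⦃a⦄, a ∈ S → π • a = a) → ∀ x ∈ s, π • x ∈ s) :
    MulAction.Supports (FinPerm 𝔸) S s := by
  intro π hπ
  refine Set.Subset.antisymm ?_ fun x hx => ?_
  · rintro _ ⟨x, hx, rfl⟩
    exact h π hπ x hx
  · exact Set.mem_smul_set_iff_inv_smul_mem.2
      (h π⁻¹ (fun a ha => inv_smul_eq_iff.2 (hπ ha).symm) x hx)

lemma smul_mem_of_supports {s : Set X} {S : Set 𝔸} (h : MulAction.Supports (FinPerm 𝔸) S s)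
    {π : FinPerm 𝔸} (hπ : ∀ ⦃a⦄, a ∈ S → π • a = a) {x : X} (hx : x ∈ s) : π • x ∈ s := by
  rw [← h π hπ]
  exact Set.smul_mem_smul_set hx

/-- A set defined by an equivariant relation from a finitely supported set is finitely
supported. -/
lemma FinSupp.setOf_exists_mem {s : Set X} (hs : FinSupp 𝔸 s) (R : X → Y → Prop)
    (hR : ∀ (π : FinPerm 𝔸) x y, R x y → R (π • x) (π • y)) :
    FinSupp 𝔸 {y | ∃ x ∈ s, R x y} := by
  obtain ⟨S, hS⟩ := hs
  refine ⟨S, supports_set_of_mem fun π hπ y => ?_⟩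
  rintro ⟨x, hx, hxy⟩
  exact ⟨π • x, smul_mem_of_supports hS hπ hx, hR π x y hxy⟩

lemma FinSupp.singleton {x : X} (hx : FinSupp 𝔸 x) : FinSupp 𝔸 ({x} : Set X) := by
  obtain ⟨S, hS⟩ := hx
  refine ⟨S, supports_set_of_mem fun π hπ y hy => ?_⟩
  rw [Set.mem_singleton_iff.1 hy, hS π hπ]
  rfl

lemma FinSupp.of_equivariant {s : Set X} (h : ∀ (π : FinPerm 𝔸), ∀ x ∈ s, π • x ∈ s) :
    FinSupp 𝔸 s :=
  ⟨∅, supports_set_of_mem fun π _ => h π⟩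

/-- An orbit-finite subset of the image of an equivariant map is the image of an orbit-finite
subset. -/
lemma OrbitFinite.exists_image_eq {s : Set Y} (hs : OrbitFinite 𝔸 s) (f : X → Y)
    (hf : ∀ (π : FinPerm 𝔸) (x : X), f (π • x) = π • f x) (h : s ⊆ Set.range f) :
    ∃ t : Set X, OrbitFinite 𝔸 t ∧ f '' t = s := by
  obtain ⟨r, hrs, hr, hr'⟩ := hs.2.exists_finite
  choose g hg using h
  have := hr.to_subtype
  refine ⟨{x | f x ∈ s ∧ ∃ y : r, ∃ π : FinPerm 𝔸, π • g (hrs y.2) = x}, ⟨?_, ?_⟩, ?_⟩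
  · obtain ⟨S, hS⟩ := hs.1
    refine ⟨S, supports_set_of_mem fun π hπ x => ?_⟩
    rintro ⟨hx, y, σ, rfl⟩
    exact ⟨hf π _ ▸ smul_mem_of_supports hS hπ hx, y, π * σ, mul_smul _ _ _⟩
  · refine .of_finite (Set.finite_range fun y : r => g (hrs y.2)) ?_
    rintro _ ⟨-, y, π, rfl⟩
    exact ⟨_, ⟨y, rfl⟩, π, rfl⟩
  · refine Set.Subset.antisymm ?_ fun x hx => ?_
    · rintro _ ⟨x, hx, rfl⟩
      exact hx.1
    · obtain ⟨y, hy, π, rfl⟩ := hr' x hx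
      have : f (π • g (hrs hy)) = π • y := by rw [hf, hg (hrs hy)]
      exact ⟨π • g (hrs hy), ⟨this ▸ hx, ⟨y, hy⟩, π, rfl⟩, this⟩

end OrbitFiniteSets

/-! ### Suprema and atoms in nominal boolean algebras -/

section Suprema

variable {𝔸 : Type a}

lemma inf_le_of_isLUB {B : Type*} [BooleanAlgebra B] {X : Set B} {s c u : B} (hs : IsLUB X s)
    (h : ∀ x ∈ X, x ⊓ c ≤ u) : s ⊓ c ≤ u :=
  le_himp_iff.1 (hs.2 fun x hx => le_himp_iff.2 (h x hx))

/-- An atom below a supremum is below one of the elements. -/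
lemma exists_le_of_isAtom_of_isLUB {B : Type*} [BooleanAlgebra B] {X : Set B} {s b : B}
    (hs : IsLUB X s) (hb : IsAtom b) (hbs : b ≤ s) : ∃ x ∈ X, b ≤ x := by
  by_contra! h
  have : s ⊓ b ≤ ⊥ := inf_le_of_isLUB hs fun x hx =>
    (disjoint_iff.1 (hb.not_le_iff_disjoint.1 (h x hx)).symm).le
  rw [inf_eq_right.2 hbs] at this
  exact hb.1 (le_bot_iff.1 this)

variable {B C : Type*} [BooleanAlgebra B] [MulAction (FinPerm 𝔸) B]
  [BooleanAlgebra C] [MulAction (FinPerm 𝔸) C]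

lemma IsNominalBA.smul_mono (hB : IsNominalBA 𝔸 B) (π : FinPerm 𝔸) {x y : B} (h : x ≤ y) :
    π • x ≤ π • y := by
  rw [← inf_eq_left, ← hB.smul_inf, inf_eq_left.2 h]

lemma IsNominalBA.smul_le_smul_iff (hB : IsNominalBA 𝔸 B) (π : FinPerm 𝔸) {x y : B} :
    π • x ≤ π • y ↔ x ≤ y :=
  ⟨fun h => by simpa using hB.smul_mono π⁻¹ h, hB.smul_mono π⟩

lemma IsNominalBA.smul_le_iff (hB : IsNominalBA 𝔸 B) (π : FinPerm 𝔸) {x y : B} :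
    π • x ≤ y ↔ x ≤ π⁻¹ • y := by
  rw [← hB.smul_le_smul_iff π⁻¹, inv_smul_smul]

lemma IsNominalBA.le_smul_iff (hB : IsNominalBA 𝔸 B) (π : FinPerm 𝔸) {x y : B} :
    x ≤ π • y ↔ π⁻¹ • x ≤ y := by
  rw [hB.smul_le_iff, inv_inv]

lemma IsNominalBA.isAtom_smul (hB : IsNominalBA 𝔸 B) (π : FinPerm 𝔸) {b : B} (hb : IsAtom b) :
    IsAtom (π • b) := by
  let e : B ≃o B := ⟨MulAction.toPerm π, hB.smul_le_smul_iff π⟩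
  exact (e.isAtom_iff b).2 hb

/-- The set of all atoms below some element of `X`. -/
def atomsBelow (X : Set B) : Set B := {b | IsAtom b ∧ ∃ x ∈ X, b ≤ x}

variable {k : ℕ}

lemma IsKAtomic.isLUB_atoms_top (h : IsKAtomic 𝔸 k B) : IsLUB {b : B | IsAtom b} ⊤ := by
  simpa using h.isLUB_atoms ⊤

lemma IsKAtomic.isLUB_atomsBelow_iff (h : IsKAtomic 𝔸 k B) {X : Set B} {s : B} :
    IsLUB (atomsBelow X) s ↔ IsLUB X s := by
  have : upperBounds (atomsBelow X) = upperBounds X := by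
    ext u
    exact ⟨fun hu x hx => (h.isLUB_atoms x).2 fun b hb => hu ⟨hb.1, x, hx, hb.2⟩,
      fun hu b ⟨_, x, hx, hbx⟩ => hbx.trans (hu hx)⟩
  rw [IsLUB, this, IsLUB]

lemma IsKAtomic.meetsFinitelyManyOrbits_atomsBelow (h : IsKAtomic 𝔸 k B) (X : Set B) :
    MeetsFinitelyManyOrbits 𝔸 (atomsBelow X) :=
  h.atoms_orbits.mono fun _ hb => hb.1

lemma IsKAtomic.orbitFinite_atomsBelow (h : IsKAtomic 𝔸 k B) (hB : IsNominalBA 𝔸 B) {X : Set B}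
    (hX : FinSupp 𝔸 X) : OrbitFinite 𝔸 (atomsBelow X) := by
  refine ⟨?_, h.meetsFinitelyManyOrbits_atomsBelow X⟩
  convert hX.setOf_exists_mem (fun x b => IsAtom b ∧ b ≤ x)
    fun π x b hb => ⟨hB.isAtom_smul π hb.1, hB.smul_mono π hb.2⟩ using 1
  ext b
  exact ⟨fun ⟨hb, x, hx, hbx⟩ => ⟨x, hx, hb, hbx⟩, fun ⟨x, hx, hb, hbx⟩ => ⟨hb, x, hx, hbx⟩⟩

lemma IsKAtomic.orbitFinite_atoms (h : IsKAtomic 𝔸 k B) (hB : IsNominalBA 𝔸 B) :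
    OrbitFinite 𝔸 {b : B | IsAtom b} :=
  ⟨.of_equivariant fun π _ hb => hB.isAtom_smul π hb, h.atoms_orbits⟩

lemma IsKAtomic.isComplete (h : IsKAtomic 𝔸 k B) (hB : IsNominalBA 𝔸 B)
    (hc : IsOFComplete 𝔸 B) : IsComplete 𝔸 B := fun _ hX =>
  let ⟨s, hs⟩ := hc _ (h.orbitFinite_atomsBelow hB hX)
  ⟨s, h.isLUB_atomsBelow_iff.1 hs⟩

/-- On a `k`-atomic algebra, preservation of orbit-finite suprema entails preservation of all
finitely supported ones: replace a finitely supported set by the atoms below its elements. -/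
lemma OFCHom.map_isLUB_of_finSupp (f : OFCHom 𝔸 B C) (h : IsKAtomic 𝔸 k B)
    (hB : IsNominalBA 𝔸 B) {X : Set B} {s : B} (hX : FinSupp 𝔸 X) (hs : IsLUB X s) :
    IsLUB (f.hom '' X) (f.hom s) := by
  have hf := f.map_isLUB _ _ (h.orbitFinite_atomsBelow hB hX) (h.isLUB_atomsBelow_iff.2 hs)
  refine ⟨?_, fun u hu => hf.2 ?_⟩
  · rintro _ ⟨x, hx, rfl⟩
    exact OrderHomClass.mono f.hom (hs.1 hx)
  · rintro _ ⟨b, ⟨-, x, hx, hbx⟩, rfl⟩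
    exact (OrderHomClass.mono f.hom hbx).trans (hu ⟨x, hx, rfl⟩)

lemma OFCHom.eq_of_eqOn_atoms {f g : OFCHom 𝔸 B C} (h : IsKAtomic 𝔸 k B) (hB : IsNominalBA 𝔸 B)
    (hfg : ∀ b : B, IsAtom b → f.hom b = g.hom b) : f = g := by
  have key : ∀ x, f.hom x = g.hom x := fun x => by
    have hx := h.isLUB_atomsBelow_iff.2 (isLUB_singleton (a := x))
    have hof := h.orbitFinite_atomsBelow hB (hB.finSupp x).singleton
    have hf := f.map_isLUB _ _ hof hx
    rw [Set.image_congr fun b hb => hfg b hb.1] at hf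
    exact hf.unique (g.map_isLUB _ _ hof hx)
  ext x
  exact key x

end Suprema

/-! ### Subalgebras and partitions -/

section Partitions

variable {𝔸 : Type a} {B : Type*} [BooleanAlgebra B] [MulAction (FinPerm 𝔸) B]

lemma Subalg.isNominalBA (A : Subalg 𝔸 B) (hB : IsNominalBA 𝔸 B) :
    IsNominalBA 𝔸 A.toBooleanSubalgebra where
  finSupp x := by
    obtain ⟨S, hS⟩ := hB.finSupp x.1
    exact ⟨S, fun π hπ => Subtype.ext (hS π hπ)⟩
  smul_sup π x y := Subtype.ext (hB.smul_sup π x.1 y.1)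
  smul_inf π x y := Subtype.ext (hB.smul_inf π x.1 y.1)
  smul_compl π x := Subtype.ext (hB.smul_compl π x.1)
  smul_top π := Subtype.ext (hB.smul_top π)
  smul_bot π := Subtype.ext (hB.smul_bot π)

lemma Subalg.isLUB_of_isLUB_val (A : Subalg 𝔸 B) {X : Set A.toBooleanSubalgebra}
    {s : A.toBooleanSubalgebra} (h : IsLUB (Subtype.val '' X) s.1) : IsLUB X s :=
  ⟨fun x hx => h.1 ⟨x, hx, rfl⟩, fun u hu => h.2 (by
    rintro _ ⟨x, hx, rfl⟩
    exact hu hx)⟩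

lemma Subalg.exists_isLUB_val (A : Subalg 𝔸 B) (hc : IsOFComplete 𝔸 B)
    {X : Set A.toBooleanSubalgebra} (hX : OrbitFinite 𝔸 X) :
    ∃ s : A.toBooleanSubalgebra, IsLUB (Subtype.val '' X) s.1 := by
  have hX' : OrbitFinite 𝔸 (Subtype.val '' X) := hX.image _ fun _ _ => rfl
  obtain ⟨s, hs⟩ := hc _ hX'
  refine ⟨⟨s, A.isLUB_mem' ?_ hX' hs⟩, hs⟩
  rintro _ ⟨x, -, rfl⟩
  exact x.2

lemma Subalg.isOFComplete (A : Subalg 𝔸 B) (hc : IsOFComplete 𝔸 B) :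
    IsOFComplete 𝔸 A.toBooleanSubalgebra := fun _ hX =>
  let ⟨s, hs⟩ := A.exists_isLUB_val hc hX
  ⟨s, A.isLUB_of_isLUB_val hs⟩

/-- The inclusion of a subalgebra. Orbit-finite suprema in the subalgebra are suprema in the
ambient algebra since the latter exist and lie in the subalgebra. -/
def Subalg.subtype (A : Subalg 𝔸 B) (hc : IsOFComplete 𝔸 B) :
    OFCHom 𝔸 A.toBooleanSubalgebra B where
  hom := A.toBooleanSubalgebra.subtype
  map_smul _ _ := rfl
  map_isLUB X s hX hs := by
    obtain ⟨t, ht⟩ := A.exists_isLUB_val hc hX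
    rw [hs.unique (A.isLUB_of_isLUB_val ht)]
    exact ht

/-- The subalgebra of all elements that split no block of an equivariant family `Z`. -/
def Subalg.ofBlocks (hB : IsNominalBA 𝔸 B) (Z : Set B)
    (hZ : ∀ π : FinPerm 𝔸, ∀ z ∈ Z, π • z ∈ Z) : Subalg 𝔸 B where
  carrier := {x | ∀ z ∈ Z, z ≤ x ∨ Disjoint z x}
  supClosed' x hx y hy z hz := by
    rcases hx z hz with h | h
    · exact .inl (h.trans le_sup_left)
    rcases hy z hz with h' | h'
    · exact .inl (h'.trans le_sup_right)
    · exact .inr (h.sup_right h')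
  infClosed' x hx y hy z hz := by
    rcases hx z hz with h | h
    · rcases hy z hz with h' | h'
      · exact .inl (le_inf h h')
      · exact .inr (h'.mono_right inf_le_right)
    · exact .inr (h.mono_right inf_le_left)
  compl_mem' {x} hx z hz := by
    rcases hx z hz with h | h
    · exact .inr (disjoint_compl_right.mono_left h)
    · exact .inl h.le_compl_right
  bot_mem' _ _ := .inr disjoint_bot_right
  smul_mem' π {x} hx z hz := by
    rw [hB.le_smul_iff, ← le_compl_iff_disjoint_right, ← hB.smul_compl, hB.le_smul_iff,
      le_compl_iff_disjoint_right]
    exact hx _ (hZ π⁻¹ z hz)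
  isLUB_mem' {X s} hX _ hs z hz := by
    by_cases h : ∃ x ∈ X, z ≤ x
    · obtain ⟨x, hx, hzx⟩ := h
      exact .inl (hzx.trans (hs.1 hx))
    · refine .inr (le_compl_iff_disjoint_left.1 (hs.2 fun x hx => ?_))
      exact ((hX hx z hz).resolve_left fun hzx => h ⟨x, hx, hzx⟩).le_compl_left

variable (𝔸) in
/-- An equivariant partition of unity into finitely many orbits of blocks. The bottom element is
allowed among the blocks. -/
structure IsPartition (Z : Set B) : Prop where
  smul_mem : ∀ π : FinPerm 𝔸, ∀ z ∈ Z, π • z ∈ Z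
  disjoint : ∀ z ∈ Z, ∀ z' ∈ Z, z ≠ z' → Disjoint z z'
  isLUB_top : IsLUB Z ⊤
  orbits : MeetsFinitelyManyOrbits 𝔸 Z

variable {k : ℕ} {Z : Set B}

lemma IsPartition.mem_ofBlocks (h : IsPartition 𝔸 Z) (hB : IsNominalBA 𝔸 B) {z : B}
    (hz : z ∈ Z) : z ∈ (Subalg.ofBlocks hB Z h.smul_mem).carrier := by
  intro z' hz'
  by_cases hzz' : z' = z
  · exact .inl hzz'.le
  · exact .inr (h.disjoint z' hz' z hz hzz')

lemma IsPartition.isLUB_blocks (h : IsPartition 𝔸 Z) (hB : IsNominalBA 𝔸 B) {x : B}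
    (hx : x ∈ (Subalg.ofBlocks hB Z h.smul_mem).carrier) : IsLUB {z | z ∈ Z ∧ z ≤ x} x := by
  refine ⟨fun z hz => hz.2, fun u hu => ?_⟩
  have : ⊤ ⊓ x ≤ u := inf_le_of_isLUB h.isLUB_top fun z hz => by
    rcases hx z hz with hzx | hzx
    · exact inf_le_left.trans (hu ⟨hz, hzx⟩)
    · rw [hzx.eq_bot]
      exact bot_le
  rwa [top_inf_eq] at this

lemma IsPartition.isAtom_ofBlocks_iff (h : IsPartition 𝔸 Z) (hB : IsNominalBA 𝔸 B)
    (x : (Subalg.ofBlocks hB Z h.smul_mem).toBooleanSubalgebra) :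
    IsAtom x ↔ x.1 ∈ Z ∧ x.1 ≠ ⊥ := by
  have key : ∀ {y : (Subalg.ofBlocks hB Z h.smul_mem).toBooleanSubalgebra}, y ≠ ⊥ →
      ∃ z ∈ Z, z ≤ y.1 ∧ z ≠ ⊥ := fun {y} hy => by
    by_contra! hne
    exact hy (Subtype.ext (le_bot_iff.1
      ((h.isLUB_blocks hB y.2).2 fun z hz => (hne z hz.1 hz.2).le)))
  constructor
  · intro hx
    obtain ⟨z, hz, hzx, hz0⟩ := key hx.1
    have : (⟨z, h.mem_ofBlocks hB hz⟩ :
        (Subalg.ofBlocks hB Z h.smul_mem).toBooleanSubalgebra) = x :=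
      (hx.le_iff.1 hzx).resolve_left fun h0 => hz0 (congrArg Subtype.val h0)
    subst this
    exact ⟨hz, hz0⟩
  · rintro ⟨hxZ, hx0⟩
    refine isAtom_iff_le_of_ge.2 ⟨fun h0 => hx0 (congrArg Subtype.val h0), fun y hy hyx => ?_⟩
    rcases y.2 x.1 hxZ with hxy | hxy
    · exact hxy
    · exact absurd (Subtype.ext (hxy.symm.eq_bot_of_le hyx)) hy

/-- The elements that split no block of a partition form an algebra whose atoms are the nonzero
blocks. -/
lemma IsPartition.isKAtomic_ofBlocks (h : IsPartition 𝔸 Z) (hB : IsNominalBA 𝔸 B)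
    (hk : ∀ z ∈ Z, z ≠ ⊥ → SuppBdd 𝔸 k z) :
    IsKAtomic 𝔸 k (Subalg.ofBlocks hB Z h.smul_mem).toBooleanSubalgebra where
  isLUB_atoms x := by
    refine ⟨fun b hb => hb.2, fun u hu => (h.isLUB_blocks hB x.2).2 fun z hz => ?_⟩
    by_cases hz0 : z = ⊥
    · exact hz0 ▸ bot_le
    · exact hu (a := ⟨z, h.mem_ofBlocks hB hz.1⟩) ⟨(h.isAtom_ofBlocks_iff hB _).2 ⟨hz.1, hz0⟩, hz.2⟩
  atoms_orbits := by
    obtain ⟨r, hrZ, hr, hr'⟩ := h.orbits.exists_finite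
    refine .of_finite (hr.preimage Subtype.val_injective.injOn) fun b hb => ?_
    obtain ⟨y, hy, π, hyb⟩ := hr' b.1 ((h.isAtom_ofBlocks_iff hB b).1 hb).1
    exact ⟨⟨y, h.mem_ofBlocks hB (hrZ hy)⟩, hy, π, Subtype.ext hyb⟩
  atoms_bdd b hb := by
    obtain ⟨hbZ, hb0⟩ := (h.isAtom_ofBlocks_iff hB b).1 hb
    obtain ⟨S, hSk, hS⟩ := hk b.1 hbZ hb0
    exact ⟨S, hSk, fun π hπ => Subtype.ext (hS π hπ)⟩

variable {A A' : Type*} [BooleanAlgebra A] [MulAction (FinPerm 𝔸) A] [BooleanAlgebra A']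
  [MulAction (FinPerm 𝔸) A']

lemma OFCHom.isPartition_image_atoms (f : OFCHom 𝔸 A B) (hA : IsNominalBA 𝔸 A)
    (h : IsKAtomic 𝔸 k A) : IsPartition 𝔸 (f.hom '' {b | IsAtom b}) where
  smul_mem := by
    rintro π _ ⟨b, hb, rfl⟩
    exact ⟨π • b, hA.isAtom_smul π hb, f.map_smul π b⟩
  disjoint := by
    rintro _ ⟨b, hb, rfl⟩ _ ⟨b', hb', rfl⟩ hne
    rw [disjoint_iff, ← map_inf, (hb.disjoint_of_ne hb' fun e => hne (e ▸ rfl)).eq_bot, map_bot]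
  isLUB_top := by
    simpa using f.map_isLUB _ _ (h.orbitFinite_atoms hA) h.isLUB_atoms_top
  orbits := h.atoms_orbits.image _ f.map_smul

lemma OFCHom.range_subset_ofBlocks (f : OFCHom 𝔸 A B) (hA : IsNominalBA 𝔸 A)
    (h : IsKAtomic 𝔸 k A) (hB : IsNominalBA 𝔸 B) :
    Set.range f.hom ⊆ (Subalg.ofBlocks hB _ (f.isPartition_image_atoms hA h).smul_mem).carrier := by
  rintro _ ⟨x, rfl⟩ _ ⟨b, hb : IsAtom b, rfl⟩
  by_cases hbx : b ≤ x
  · exact .inl (OrderHomClass.mono f.hom hbx)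
  · refine .inr ?_
    rw [disjoint_iff, ← map_inf, (hb.not_le_iff_disjoint.1 hbx).eq_bot, map_bot]

/-- The image of a `k`-atomic algebra is contained in a `k`-atomic subalgebra. -/
lemma OFCHom.exists_isKAtomic_range_subset (f : OFCHom 𝔸 A B) (hA : IsNominalBA 𝔸 A)
    (h : IsKAtomic 𝔸 k A) (hB : IsNominalBA 𝔸 B) :
    ∃ S : Subalg 𝔸 B, IsKAtomic 𝔸 k S.toBooleanSubalgebra ∧ Set.range f.hom ⊆ S.carrier := by
  refine ⟨_, (f.isPartition_image_atoms hA h).isKAtomic_ofBlocks hB ?_,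
    f.range_subset_ofBlocks hA h hB⟩
  rintro _ ⟨b, hb, rfl⟩ -
  exact (h.atoms_bdd b hb).map _ f.map_smul

lemma IsPartition.image2_inf {Z Z' : Set B} (h : IsPartition 𝔸 Z) (h' : IsPartition 𝔸 Z')
    (hB : IsNominalBA 𝔸 B) : IsPartition 𝔸 (Set.image2 (· ⊓ ·) Z Z') where
  smul_mem := by
    rintro π _ ⟨z, hz, z', hz', rfl⟩
    exact ⟨π • z, h.smul_mem π z hz, π • z', h'.smul_mem π z' hz', (hB.smul_inf π z z').symm⟩
  disjoint := by
    rintro _ ⟨x, hx, x', hx', rfl⟩ _ ⟨y, hy, y', hy', rfl⟩ hne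
    by_cases hxy : x = y
    · refine (h'.disjoint x' hx' y' hy' fun e => hne ?_).mono inf_le_right inf_le_right
      rw [hxy, e]
    · exact (h.disjoint x hx y hy hxy).mono inf_le_left inf_le_left
  isLUB_top := by
    refine ⟨fun _ _ => le_top, fun u hu => h.isLUB_top.2 fun z hz => ?_⟩
    have : ⊤ ⊓ z ≤ u := inf_le_of_isLUB h'.isLUB_top fun z' hz' => by
      rw [inf_comm]
      exact hu ⟨z, hz, z', hz', rfl⟩
    rwa [top_inf_eq] at this
  orbits := h.orbits.image2 h'.orbits (fun x _ => hB.finSupp x) (fun x _ => hB.finSupp x) _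
    fun π x y => (hB.smul_inf π x y).symm

/-- In a locally `k`-atomic algebra the nonzero blocks of every partition automatically have
supports with at most `k` elements: a block `z` lies above an atom `q` of a `k`-atomic subalgebra
containing `z`, and a permutation `π` that fixes `q` cannot move `z`, for `q ≤ z ⊓ π • z`. -/
lemma IsPartition.suppBdd (h : IsPartition 𝔸 Z) (hB : IsNominalBA 𝔸 B)
    (hl : IsLocallyKAtomic 𝔸 k B) {z : B} (hz : z ∈ Z) (hz0 : z ≠ ⊥) : SuppBdd 𝔸 k z := by
  obtain ⟨C, hC, hzC⟩ := hl z
  obtain ⟨q, hq, hqz⟩ : ∃ q : C.toBooleanSubalgebra, IsAtom q ∧ q ≤ ⟨z, hzC⟩ := by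
    by_contra! hne
    exact hz0 (congrArg Subtype.val (le_bot_iff.1
      ((hC.isLUB_atoms ⟨z, hzC⟩).2 fun q hq => absurd hq.2 (hne q hq.1))))
  obtain ⟨S, hSk, hS⟩ := hC.atoms_bdd q hq
  refine ⟨S, hSk, fun π hπ => ?_⟩
  by_contra hne
  have hqπ : π • q.1 = q.1 := congrArg Subtype.val (hS π hπ)
  have hd := h.disjoint _ (h.smul_mem π z hz) z hz hne
  have : q.1 ≤ ⊥ := hd (hqπ ▸ hB.smul_mono π hqz) hqz
  exact hq.1 (Subtype.ext (le_bot_iff.1 this))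

/-- The `k`-atomic subalgebras of a locally `k`-atomic algebra are directed: take the common
refinement of the two partitions into atoms. -/
lemma IsLocallyKAtomic.exists_isKAtomic_superset (hl : IsLocallyKAtomic 𝔸 k B)
    (hB : IsNominalBA 𝔸 B) (hc : IsOFComplete 𝔸 B) {A₁ A₂ : Subalg 𝔸 B}
    (h₁ : IsKAtomic 𝔸 k A₁.toBooleanSubalgebra) (h₂ : IsKAtomic 𝔸 k A₂.toBooleanSubalgebra) :
    ∃ S : Subalg 𝔸 B, IsKAtomic 𝔸 k S.toBooleanSubalgebra ∧
      A₁.carrier ⊆ S.carrier ∧ A₂.carrier ⊆ S.carrier := by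
  have hP₁ := (A₁.subtype hc).isPartition_image_atoms (A₁.isNominalBA hB) h₁
  have hP₂ := (A₂.subtype hc).isPartition_image_atoms (A₂.isNominalBA hB) h₂
  have hP := hP₁.image2_inf hP₂ hB
  refine ⟨_, hP.isKAtomic_ofBlocks hB fun z hz hz0 => hP.suppBdd hB hl hz hz0, ?_, ?_⟩
  · rintro x hx _ ⟨z, hz, z', hz', rfl⟩
    exact ((A₁.subtype hc).range_subset_ofBlocks (A₁.isNominalBA hB) h₁ hB
      ⟨⟨x, hx⟩, rfl⟩ z hz).imp inf_le_left.trans fun hd => hd.mono_left inf_le_left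
  · rintro x hx _ ⟨z, hz, z', hz', rfl⟩
    exact ((A₂.subtype hc).range_subset_ofBlocks (A₂.isNominalBA hB) h₂ hB
      ⟨⟨x, hx⟩, rfl⟩ z' hz').imp inf_le_right.trans fun hd => hd.mono_left inf_le_right

end Partitions

/-! ### Homomorphisms out of a `k`-atomic algebra -/

section AtomsExtension

variable {𝔸 : Type a} {k : ℕ} {A D : Type*} [BooleanAlgebra A] [MulAction (FinPerm 𝔸) A]
  [BooleanAlgebra D] [MulAction (FinPerm 𝔸) D]

/-- An equivariant map sending the atoms of a `k`-atomic algebra to a partition of unity extends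
to a homomorphism, whose value at `x` is the supremum of the blocks assigned to the atoms
below `x`. -/
lemma IsKAtomic.exists_hom_extending (h : IsKAtomic 𝔸 k A) (hA : IsNominalBA 𝔸 A)
    (hD : IsNominalBA 𝔸 D) (hc : IsOFComplete 𝔸 D) (g : A → D)
    (hg : ∀ (π : FinPerm 𝔸) (x : A), g (π • x) = π • g x)
    (hdisj : ∀ b b' : A, IsAtom b → IsAtom b' → b ≠ b' → Disjoint (g b) (g b'))
    (htop : IsLUB (g '' {b | IsAtom b}) ⊤) :
    ∃ f : OFCHom 𝔸 A D, ∀ b, IsAtom b → f.hom b = g b := by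
  have hex : ∀ x : A, ∃ s, IsLUB (g '' atomsBelow {x}) s := fun x =>
    hc _ ((h.orbitFinite_atomsBelow hA (hA.finSupp x).singleton).image g hg)
  choose e he using hex
  have hle : ∀ {b x : A}, IsAtom b → b ≤ x → g b ≤ e x := fun {b x} hb hbx =>
    (he x).1 ⟨b, ⟨hb, x, rfl, hbx⟩, rfl⟩
  have hup : ∀ {x : A} {u : D}, (∀ b, IsAtom b → b ≤ x → g b ≤ u) → e x ≤ u := fun {x u} hu =>
    (he x).2 (by
      rintro _ ⟨b, ⟨hb, y, rfl, hby⟩, rfl⟩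
      exact hu b hb hby)
  have hmono : Monotone e := fun x y hxy => hup fun b hb hbx => hle hb (hbx.trans hxy)
  have hsup : ∀ x y, e (x ⊔ y) = e x ⊔ e y := fun x y => by
    refine le_antisymm (hup fun b hb hbxy => ?_)
      (sup_le (hmono le_sup_left) (hmono le_sup_right))
    obtain ⟨z, hz, hbz⟩ := exists_le_of_isAtom_of_isLUB (isLUB_pair (a := x) (b := y)) hb hbxy
    rcases hz with rfl | rfl
    · exact (hle hb hbz).trans le_sup_left
    · exact (hle hb hbz).trans le_sup_right
  have hinf : ∀ x y, e (x ⊓ y) = e x ⊓ e y := fun x y => by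
    refine le_antisymm (le_inf (hmono inf_le_left) (hmono inf_le_right)) ?_
    refine inf_le_of_isLUB (he x) ?_
    rintro _ ⟨b, ⟨hb, x, rfl, hbx⟩, rfl⟩
    rw [inf_comm]
    refine inf_le_of_isLUB (he y) ?_
    rintro _ ⟨b', ⟨hb', y, rfl, hby⟩, rfl⟩
    by_cases hbb' : b = b'
    · subst hbb'
      exact inf_le_left.trans (hle hb (le_inf hbx hby))
    · rw [inf_comm, (hdisj b b' hb hb' hbb').eq_bot]
      exact bot_le
  have hetop : e ⊤ = ⊤ := top_unique (htop.2 (by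
    rintro _ ⟨b, hb, rfl⟩
    exact hle hb le_top))
  have hebot : e ⊥ = ⊥ := bot_unique (hup fun b hb hb0 => absurd (le_bot_iff.1 hb0) hb.1)
  refine ⟨⟨⟨⟨⟨e, hsup⟩, hinf⟩, hetop, hebot⟩, fun π x => ?_, fun X s hX hs => ?_⟩, fun b hb => ?_⟩
  · change e (π • x) = π • e x
    have key : ∀ (π : FinPerm 𝔸) x, e (π • x) ≤ π • e x := fun π x => hup fun b hb hbx => by
      rw [hD.le_smul_iff, ← hg]
      exact hle (hA.isAtom_smul π⁻¹ hb) ((hA.le_smul_iff π).1 hbx)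
    refine le_antisymm (key π x) ?_
    rw [hD.smul_le_iff]
    simpa using key π⁻¹ (π • x)
  · change IsLUB (e '' X) (e s)
    refine ⟨?_, fun u hu => hup fun b hb hbs => ?_⟩
    · rintro _ ⟨x, hx, rfl⟩
      exact hmono (hs.1 hx)
    · obtain ⟨x, hx, hbx⟩ := exists_le_of_isAtom_of_isLUB hs hb hbs
      exact (hle hb hbx).trans (hu ⟨x, hx, rfl⟩)
  · change e b = g b
    refine le_antisymm (hup fun b' hb' hbb' => ?_) (hle hb le_rfl)
    rw [(hb.le_iff.1 hbb').resolve_left hb'.1]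

end AtomsExtension

/-! ### Directed colimits of locally `k`-atomic algebras -/

/-- The function out of a directed union induced by a compatible family of functions. -/
lemma exists_desc_of_directed {J : Type*} [Preorder J] [IsDirectedOrder J] {X : J → Type*}
    {L M : Type*} (t : ∀ ⦃i j⦄, i ≤ j → X i → X j) (c : ∀ i, X i → L)
    (hct : ∀ ⦃i j⦄ (h : i ≤ j) x, c j (t h x) = c i x) (hsurj : ∀ l, ∃ i x, c i x = l)
    (hinj : ∀ i x y, c i x = c i y → ∃ (j : J) (h : i ≤ j), t h x = t h y)
    (s : ∀ i, X i → M) (hst : ∀ ⦃i j⦄ (h : i ≤ j) x, s j (t h x) = s i x) :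
    ∃ d : L → M, ∀ i x, d (c i x) = s i x := by
  choose I y hy using hsurj
  refine ⟨fun l => s (I l) (y l), fun i x => ?_⟩
  obtain ⟨m, h₁, h₂⟩ := exists_ge_ge (I (c i x)) i
  obtain ⟨n, hn, e⟩ := hinj m (t h₁ (y (c i x))) (t h₂ x) (by rw [hct, hct, hy])
  change s _ (y (c i x)) = s i x
  rw [← hst h₁, ← hst hn, e, hst, hst]

section NomColimits

variable {𝔸 : Type a} {J : Type w} [Preorder J] [IsDirectedOrder J]

/-- The equivariant map underlying a morphism of nominal sets. -/
abbrev Nom.toMap {X Y : Nom.{a, u} 𝔸} (f : X ⟶ Y) : X.carrier →[FinPerm 𝔸] Y.carrier := f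

lemma Nom.toMap_congr {X Y : Nom.{a, u} 𝔸} {f g : X ⟶ Y} (h : f = g) (x : X.carrier) :
    Nom.toMap f x = Nom.toMap g x := by
  rw [h]

lemma Nom.toMap_ext {X Y : Nom.{a, u} 𝔸} {f g : X ⟶ Y}
    (h : ∀ x, Nom.toMap f x = Nom.toMap g x) : f = g :=
  MulActionHom.ext h

/-- A cocone on a directed diagram of nominal sets is a colimit if it is jointly surjective and
identifies only elements that become equal at a later stage. -/
lemma Nom.nonempty_isColimit {G : J ⥤ Nom.{a, u} 𝔸} (c : Cocone G)
    (hsurj : ∀ l : c.pt.carrier, ∃ i x, Nom.toMap (c.ι.app i) x = l)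
    (hinj : ∀ i (x y : (G.obj i).carrier), Nom.toMap (c.ι.app i) x = Nom.toMap (c.ι.app i) y →
      ∃ (j : J) (h : i ≤ j),
        Nom.toMap (G.map (homOfLE h)) x = Nom.toMap (G.map (homOfLE h)) y) :
    Nonempty (IsColimit c) := by
  have hw : ∀ (s : Cocone G) ⦃i j : J⦄ (h : i ≤ j) (x : (G.obj i).carrier),
      Nom.toMap (s.ι.app j) (Nom.toMap (G.map (homOfLE h)) x) = Nom.toMap (s.ι.app i) x :=
    fun s i j h x => Nom.toMap_congr (s.w (homOfLE h)) x
  have hd : ∀ s : Cocone G, ∃ d : c.pt.carrier → s.pt.carrier, ∀ i (x : (G.obj i).carrier),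
      d (Nom.toMap (c.ι.app i) x) = Nom.toMap (s.ι.app i) x := fun s => by
    refine exists_desc_of_directed (X := fun i => (G.obj i).carrier) (L := c.pt.carrier)
      (M := s.pt.carrier) (fun i j h => (Nom.toMap (G.map (homOfLE h))).toFun)
      (fun i => (Nom.toMap (c.ι.app i)).toFun) (hw c) hsurj hinj
      (fun i => (Nom.toMap (s.ι.app i)).toFun) (hw s)
  choose d hd using hd
  refine ⟨{ desc := fun s => (⟨d s, fun π l => ?_⟩ : c.pt.carrier →[FinPerm 𝔸] s.pt.carrier)
            fac := fun s i => ?_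
            uniq := fun s m hm => ?_ }⟩
  · obtain ⟨i, x, rfl⟩ := hsurj l
    change d s (π • _) = π • d s _
    rw [hd, ← map_smul, ← map_smul, hd]
  · exact Nom.toMap_ext fun x => hd s i x
  · refine Nom.toMap_ext fun l => ?_
    obtain ⟨i, x, rfl⟩ := hsurj l
    exact (Nom.toMap_congr (hm i) x).trans (hd s i x).symm

end NomColimits

section Legs

variable {𝔸 : Type a} {k : ℕ}

/-- The homomorphism underlying a morphism of locally `k`-atomic algebras. -/
abbrev LocKAtomicOFCBA.toHom {B C : LocKAtomicOFCBA.{a, u} 𝔸 k} (f : B ⟶ C) :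
    OFCHom 𝔸 B.obj.carrier C.obj.carrier := f.hom

open LocKAtomicOFCBA (toHom)

lemma toHom_comp_apply {B C D : LocKAtomicOFCBA.{a, u} 𝔸 k} (f : B ⟶ C) (g : C ⟶ D)
    (x : B.obj.carrier) : (toHom (f ≫ g)).hom x = (toHom g).hom ((toHom f).hom x) := rfl

lemma toHom_ext {B C : LocKAtomicOFCBA.{a, u} 𝔸 k} {f g : B ⟶ C}
    (h : ∀ x, (toHom f).hom x = (toHom g).hom x) : f = g :=
  ObjectProperty.hom_ext _ (OFCHom.ext (DFunLike.ext _ _ h))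

variable {J : Type w} [Preorder J]

/-- The transition maps of a diagram of algebras. -/
abbrev transition (K : J ⥤ LocKAtomicOFCBA.{a, u} 𝔸 k) ⦃i j : J⦄ (h : i ≤ j) :
    OFCHom 𝔸 (K.obj i).obj.carrier (K.obj j).obj.carrier := toHom (K.map (homOfLE h))

/-- The legs of a cocone of algebras. -/
abbrev leg {K : J ⥤ LocKAtomicOFCBA.{a, u} 𝔸 k} (c : Cocone K) (i : J) :
    OFCHom 𝔸 (K.obj i).obj.carrier c.pt.obj.carrier := toHom (c.ι.app i)

variable {K : J ⥤ LocKAtomicOFCBA.{a, u} 𝔸 k}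

lemma leg_transition (c : Cocone K) ⦃i j : J⦄ (h : i ≤ j) (x : (K.obj i).obj.carrier) :
    (leg c j).hom ((transition K h).hom x) = (leg c i).hom x := by
  rw [← toHom_comp_apply, c.w]

lemma transition_transition (K : J ⥤ LocKAtomicOFCBA.{a, u} 𝔸 k) ⦃i j l : J⦄ (h : i ≤ j)
    (h' : j ≤ l) (x : (K.obj i).obj.carrier) :
    (transition K h').hom ((transition K h).hom x) = (transition K (h.trans h')).hom x := by
  rw [← toHom_comp_apply, ← K.map_comp]
  rfl

lemma transition_self (K : J ⥤ LocKAtomicOFCBA.{a, u} 𝔸 k) ⦃i : J⦄ (x : (K.obj i).obj.carrier) :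
    (transition K (le_refl i)).hom x = x := by
  have : K.map (homOfLE (le_refl i)) = 𝟙 _ := K.map_id i
  rw [transition, this]
  rfl

/-- The cocone is a directed union on underlying sets: it is jointly surjective and identifies only
elements that become equal at a later stage. -/
structure IsDirectedUnion (c : Cocone K) : Prop where
  surj : ∀ l : c.pt.obj.carrier, ∃ i x, (leg c i).hom x = l
  inj : ∀ i x y, (leg c i).hom x = (leg c i).hom y →
    ∃ (j : J) (h : i ≤ j), (transition K h).hom x = (transition K h).hom y

variable [IsDirectedOrder J]

lemma IsDirectedUnion.nonempty_isColimit_forget {c : Cocone K} (hc : IsDirectedUnion c) :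
    Nonempty (IsColimit ((forgetNom.{a, u} 𝔸 k).mapCocone c)) :=
  Nom.nonempty_isColimit _ hc.surj hc.inj

variable [Nonempty J]

lemma IsDirectedUnion.exists_common_stage {c : Cocone K} (hc : IsDirectedUnion c)
    {X : Set c.pt.obj.carrier} (hX : MeetsFinitelyManyOrbits 𝔸 X) :
    ∃ i, X ⊆ Set.range (leg c i).hom :=
  hX.exists_uniform (fun i l => l ∈ Set.range (leg c i).hom)
    (by
      rintro i j _ hij ⟨x, rfl⟩
      exact ⟨(transition K hij).hom x, leg_transition c hij x⟩)
    (by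
      rintro i π _ ⟨x, rfl⟩
      exact ⟨π • x, (leg c i).map_smul π x⟩)
    fun l _ => hc.surj l

/-- A directed union is a colimit. That the induced map preserves the supremum of an orbit-finite
set may be checked at a single stage, where such a set lives. -/
lemma IsDirectedUnion.nonempty_isColimit {c : Cocone K} (hc : IsDirectedUnion c) :
    Nonempty (IsColimit c) := by
  have hd : ∀ s : Cocone K, ∃ d : c.pt.obj.carrier → s.pt.obj.carrier, ∀ i x,
      d ((leg c i).hom x) = (leg s i).hom x := fun s =>
    exists_desc_of_directed (fun i j h => (transition K h).hom) (fun i => (leg c i).hom)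
      (leg_transition c) hc.surj hc.inj (fun i => (leg s i).hom) (leg_transition s)
  choose d hd using hd
  have hsurj₂ : ∀ l m : c.pt.obj.carrier, ∃ i x y, (leg c i).hom x = l ∧ (leg c i).hom y = m := by
    intro l m
    obtain ⟨i, x, rfl⟩ := hc.surj l
    obtain ⟨j, y, rfl⟩ := hc.surj m
    obtain ⟨n, hi, hj⟩ := exists_ge_ge i j
    exact ⟨n, _, _, leg_transition c hi x, leg_transition c hj y⟩
  let D : ∀ s : Cocone K, OFCHom 𝔸 c.pt.obj.carrier s.pt.obj.carrier := fun s =>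
    { hom :=
        { toFun := d s
          map_sup' := fun l m => by
            obtain ⟨i, x, y, rfl, rfl⟩ := hsurj₂ l m
            rw [← map_sup, hd, hd, hd, map_sup]
          map_inf' := fun l m => by
            obtain ⟨i, x, y, rfl, rfl⟩ := hsurj₂ l m
            rw [← map_inf, hd, hd, hd, map_inf]
          map_top' := by
            obtain ⟨i⟩ := ‹Nonempty J›
            rw [← map_top (leg c i).hom, hd, map_top]
          map_bot' := by
            obtain ⟨i⟩ := ‹Nonempty J›
            rw [← map_bot (leg c i).hom, hd, map_bot] }
      map_smul := fun π l => by
        obtain ⟨i, x, rfl⟩ := hc.surj l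
        change d s _ = π • d s _
        rw [← (leg c i).map_smul, hd, hd, (leg s i).map_smul]
      map_isLUB := fun X l hX hl => by
        obtain ⟨i, hi⟩ := hc.exists_common_stage hX.2
        obtain ⟨Y, hY, rfl⟩ := hX.exists_image_eq _ (leg c i).map_smul hi
        obtain ⟨y, hy⟩ := (K.obj i).obj.ofComplete Y hY
        obtain rfl := hl.unique ((leg c i).map_isLUB Y y hY hy)
        change IsLUB (d s '' _) (d s _)
        rw [hd, Set.image_image, Set.image_congr fun x _ => hd s i x]
        exact (leg s i).map_isLUB Y y hY hy }
  refine ⟨{ desc := fun s => ObjectProperty.homMk (D s)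
            fac := fun s i => toHom_ext fun x => hd s i x
            uniq := fun s m hm => toHom_ext fun l => ?_ }⟩
  obtain ⟨i, x, rfl⟩ := hc.surj l
  have := congrArg (fun f => (toHom f).hom x) (hm i)
  exact this.trans (hd s i x).symm

end Legs

/-! ### The underlying directed union -/

section DirectedUnion

variable {𝔸 : Type a} {k : ℕ} {J : Type u} [Preorder J] [IsDirectedOrder J]
  (K : J ⥤ LocKAtomicOFCBA.{a, u} 𝔸 k)

instance : DirectedSystem (fun i => (K.obj i).obj.carrier)
    (fun _ _ h => (transition K h).hom) where
  map_self := transition_self K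
  map_map _ _ _ h h' x := transition_transition K h h' x

/-- The directed union of the underlying sets of a diagram of algebras. -/
def ColimCarrier : Type u :=
  DirectLimit (fun i => (K.obj i).obj.carrier) (fun _ _ h => (transition K h).hom)

namespace ColimCarrier

variable {K}

/-- The element of the directed union represented by an element of stage `i`. -/
def mk (i : J) (x : (K.obj i).obj.carrier) : ColimCarrier K :=
  Quotient.mk _ ⟨i, x⟩

lemma mk_eq_mk {i j : J} {x : (K.obj i).obj.carrier} {y : (K.obj j).obj.carrier} :
    mk i x = mk j y ↔ ∃ (l : J) (hi : i ≤ l) (hj : j ≤ l),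
      (transition K hi).hom x = (transition K hj).hom y :=
  Quotient.eq

lemma mk_transition {i j : J} (h : i ≤ j) (x : (K.obj i).obj.carrier) :
    mk j ((transition K h).hom x) = mk i x :=
  mk_eq_mk.2 ⟨j, le_rfl, h, transition_self K _⟩

lemma exists_mk (l : ColimCarrier K) : ∃ i x, mk i x = l := by
  obtain ⟨i, x, h⟩ := DirectLimit.exists_eq_mk _ l
  exact ⟨i, x, h.symm⟩

lemma exists_mk₂ (l m : ColimCarrier K) : ∃ i x y, mk i x = l ∧ mk i y = m := by
  obtain ⟨i, x, y, h, h'⟩ := DirectLimit.exists_eq_mk₂ _ l m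
  exact ⟨i, x, y, h.symm, h'.symm⟩

lemma exists_mk₃ (l m n : ColimCarrier K) :
    ∃ i x y z, mk i x = l ∧ mk i y = m ∧ mk i z = n := by
  obtain ⟨i, x, y, z, h, h', h''⟩ := DirectLimit.exists_eq_mk₃ _ l m n
  exact ⟨i, x, y, z, h.symm, h'.symm, h''.symm⟩

/-- The binary operation on the directed union induced by compatible operations on the stages. -/
noncomputable def map₂
    (op : ∀ i, (K.obj i).obj.carrier → (K.obj i).obj.carrier → (K.obj i).obj.carrier)
    (hop : ∀ i j (h : i ≤ j) x y, (transition K h).hom (op i x y) =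
      op j ((transition K h).hom x) ((transition K h).hom y)) :
    ColimCarrier K → ColimCarrier K → ColimCarrier K :=
  DirectLimit.map₂ (F₁ := fun i => (K.obj i).obj.carrier) (F₂ := fun i => (K.obj i).obj.carrier)
    (F := fun i => (K.obj i).obj.carrier) (fun _ _ h => (transition K h).hom)
    (fun _ _ h => (transition K h).hom) (fun _ _ h => (transition K h).hom) op hop

lemma map₂_mk
    (op : ∀ i, (K.obj i).obj.carrier → (K.obj i).obj.carrier → (K.obj i).obj.carrier)
    (hop : ∀ i j (h : i ≤ j) x y, (transition K h).hom (op i x y) =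
      op j ((transition K h).hom x) ((transition K h).hom y))
    (i : J) (x y : (K.obj i).obj.carrier) : map₂ op hop (mk i x) (mk i y) = mk i (op i x y) :=
  DirectLimit.map₂_def (F₁ := fun i => (K.obj i).obj.carrier)
    (F₂ := fun i => (K.obj i).obj.carrier) (F := fun i => (K.obj i).obj.carrier)
    (fun _ _ h => (transition K h).hom) (fun _ _ h => (transition K h).hom)
    (fun _ _ h => (transition K h).hom) op hop i x y

section Lattice

-- These instances are local: outside this section they are projections of the lattice structure.
noncomputable local instance : Max (ColimCarrier K) :=
  ⟨map₂ (fun _ x y => x ⊔ y) fun _ _ _ _ _ => map_sup _ _ _⟩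

noncomputable local instance : Min (ColimCarrier K) :=
  ⟨map₂ (fun _ x y => x ⊓ y) fun _ _ _ _ _ => map_inf _ _ _⟩

noncomputable instance : Lattice (ColimCarrier K) :=
  have mk_sup : ∀ (i : J) (x y : (K.obj i).obj.carrier), mk i (x ⊔ y) = mk i x ⊔ mk i y :=
    fun i x y => by
      refine Eq.trans (map₂_mk (fun _ x y => x ⊔ y) (fun _ _ _ _ _ => map_sup _ _ _) i x y).symm ?_
      rfl
  have mk_inf : ∀ (i : J) (x y : (K.obj i).obj.carrier), mk i (x ⊓ y) = mk i x ⊓ mk i y :=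
    fun i x y => by
      refine Eq.trans (map₂_mk (fun _ x y => x ⊓ y) (fun _ _ _ _ _ => map_inf _ _ _) i x y).symm ?_
      rfl
  Lattice.mk'
    (fun l m => by
      obtain ⟨i, x, y, rfl, rfl⟩ := exists_mk₂ l m
      rw [← mk_sup, ← mk_sup, sup_comm])
    (fun l m n => by
      obtain ⟨i, x, y, z, rfl, rfl, rfl⟩ := exists_mk₃ l m n
      simp only [← mk_sup, sup_assoc])
    (fun l m => by
      obtain ⟨i, x, y, rfl, rfl⟩ := exists_mk₂ l m
      rw [← mk_inf, ← mk_inf, inf_comm])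
    (fun l m n => by
      obtain ⟨i, x, y, z, rfl, rfl, rfl⟩ := exists_mk₃ l m n
      simp only [← mk_inf, inf_assoc])
    (fun l m => by
      obtain ⟨i, x, y, rfl, rfl⟩ := exists_mk₂ l m
      rw [← mk_inf, ← mk_sup, sup_inf_self])
    (fun l m => by
      obtain ⟨i, x, y, rfl, rfl⟩ := exists_mk₂ l m
      rw [← mk_sup, ← mk_inf, inf_sup_self])

end Lattice

lemma mk_sup (i : J) (x y : (K.obj i).obj.carrier) : mk i (x ⊔ y) = mk i x ⊔ mk i y := by
  refine Eq.trans (map₂_mk (fun _ x y => x ⊔ y) (fun _ _ _ _ _ => map_sup _ _ _) i x y).symm ?_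
  rfl

lemma mk_inf (i : J) (x y : (K.obj i).obj.carrier) : mk i (x ⊓ y) = mk i x ⊓ mk i y := by
  refine Eq.trans (map₂_mk (fun _ x y => x ⊓ y) (fun _ _ _ _ _ => map_inf _ _ _) i x y).symm ?_
  rfl

lemma mk_mono (i : J) {x y : (K.obj i).obj.carrier} (h : x ≤ y) : mk i x ≤ mk i y := by
  rw [← sup_eq_right, ← mk_sup, sup_eq_right.2 h]

lemma mk_le_mk {i : J} {x y : (K.obj i).obj.carrier} :
    mk i x ≤ mk i y ↔ ∃ (j : J) (h : i ≤ j), (transition K h).hom x ≤ (transition K h).hom y := by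
  constructor
  · intro h
    rw [← sup_eq_right, ← mk_sup, mk_eq_mk] at h
    obtain ⟨j, h₁, h₂, e⟩ := h
    refine ⟨j, h₁, ?_⟩
    rw [map_sup] at e
    exact sup_eq_right.1 e
  · rintro ⟨j, h, hxy⟩
    rw [← mk_transition h x, ← mk_transition h y]
    exact mk_mono j hxy

instance : Compl (ColimCarrier K) :=
  ⟨DirectLimit.map _ _ (fun _ x => xᶜ) fun _ _ _ _ => map_compl' _ _⟩

lemma mk_compl (i : J) (x : (K.obj i).obj.carrier) : mk i xᶜ = (mk i x)ᶜ :=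
  rfl

instance : MulAction (FinPerm 𝔸) (ColimCarrier K) where
  smul π := DirectLimit.map _ _ (fun _ x => π • x) fun _ _ h x =>
    (transition K h).map_smul π x
  one_smul l := by
    obtain ⟨i, x, rfl⟩ := exists_mk l
    exact congrArg (mk i) (one_smul _ x)
  mul_smul π σ l := by
    obtain ⟨i, x, rfl⟩ := exists_mk l
    exact congrArg (mk i) (mul_smul π σ x)

lemma mk_smul (i : J) (π : FinPerm 𝔸) (x : (K.obj i).obj.carrier) : mk i (π • x) = π • mk i x :=
  rfl

variable [Nonempty J]

noncomputable instance : Top (ColimCarrier K) := ⟨mk (Classical.arbitrary J) ⊤⟩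

noncomputable instance : Bot (ColimCarrier K) := ⟨mk (Classical.arbitrary J) ⊥⟩

lemma mk_top (i : J) : mk i (⊤ : (K.obj i).obj.carrier) = ⊤ := by
  obtain ⟨l, hi, hj⟩ := exists_ge_ge i (Classical.arbitrary J)
  exact mk_eq_mk.2 ⟨l, hi, hj, by rw [map_top, map_top]⟩

lemma mk_bot (i : J) : mk i (⊥ : (K.obj i).obj.carrier) = ⊥ := by
  obtain ⟨l, hi, hj⟩ := exists_ge_ge i (Classical.arbitrary J)
  exact mk_eq_mk.2 ⟨l, hi, hj, by rw [map_bot, map_bot]⟩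

noncomputable instance : BooleanAlgebra (ColimCarrier K) where
  le_sup_inf l m n := by
    obtain ⟨i, x, y, z, rfl, rfl, rfl⟩ := exists_mk₃ l m n
    simp only [← mk_sup, ← mk_inf]
    exact mk_mono i le_sup_inf
  inf_compl_le_bot l := by
    obtain ⟨i, x, rfl⟩ := exists_mk l
    rw [← mk_compl, ← mk_inf, inf_compl_self, mk_bot]
  top_le_sup_compl l := by
    obtain ⟨i, x, rfl⟩ := exists_mk l
    rw [← mk_compl, ← mk_sup, sup_compl_eq_top, mk_top]
  le_top l := by
    obtain ⟨i, x, rfl⟩ := exists_mk l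
    rw [← mk_top i]
    exact mk_mono i le_top
  bot_le l := by
    obtain ⟨i, x, rfl⟩ := exists_mk l
    rw [← mk_bot i]
    exact mk_mono i bot_le

variable (K) in
lemma isNominalBA : IsNominalBA 𝔸 (ColimCarrier K) where
  finSupp l := by
    obtain ⟨i, x, rfl⟩ := exists_mk l
    exact ((K.obj i).obj.nominal.finSupp x).map (mk i) (mk_smul i)
  smul_sup π l m := by
    obtain ⟨i, x, y, rfl, rfl⟩ := exists_mk₂ l m
    simp only [← mk_sup, ← mk_smul, (K.obj i).obj.nominal.smul_sup]
  smul_inf π l m := by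
    obtain ⟨i, x, y, rfl, rfl⟩ := exists_mk₂ l m
    simp only [← mk_inf, ← mk_smul, (K.obj i).obj.nominal.smul_inf]
  smul_compl π l := by
    obtain ⟨i, x, rfl⟩ := exists_mk l
    simp only [← mk_compl, ← mk_smul, (K.obj i).obj.nominal.smul_compl]
  smul_top π := by
    obtain ⟨i⟩ := ‹Nonempty J›
    rw [← mk_top i, ← mk_smul, (K.obj i).obj.nominal.smul_top]
  smul_bot π := by
    obtain ⟨i⟩ := ‹Nonempty J›
    rw [← mk_bot i, ← mk_smul, (K.obj i).obj.nominal.smul_bot]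

/-- The coprojections preserve suprema of orbit-finite sets `X`. Let `v` represent an upper bound
in the directed union. Every `x ∈ X` lies below `v` from some stage on; as there are only finitely
many orbits of pairs `(x, v)`, one stage suffices for all of them. -/
lemma isLUB_mk (i : J) {X : Set (K.obj i).obj.carrier} {s : (K.obj i).obj.carrier}
    (hX : OrbitFinite 𝔸 X) (hs : IsLUB X s) : IsLUB (mk i '' X) (mk i s) := by
  refine ⟨?_, fun l hl => ?_⟩
  · rintro _ ⟨x, hx, rfl⟩
    exact mk_mono i (hs.1 hx)
  obtain ⟨j, v, rfl⟩ := exists_mk l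
  obtain ⟨n, hin, hjn⟩ := exists_ge_ge i j
  rw [← mk_transition hjn v] at hl ⊢
  set v' := (transition K hjn).hom v
  have hX' := hX.image _ (transition K hin).map_smul
  have hpairs : MeetsFinitelyManyOrbits 𝔸 (((transition K hin).hom '' X) ×ˢ {v'}) :=
    hX'.2.prod (.singleton v') (fun x _ => (K.obj n).obj.nominal.finSupp x)
      fun x _ => (K.obj n).obj.nominal.finSupp x
  obtain ⟨m₀, hm₀⟩ := hpairs.exists_uniform
    (fun m p => ∃ h : n ≤ m, (transition K h).hom p.1 ≤ (transition K h).hom p.2)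
    (by
      rintro m m' p hmm' ⟨hm, hp⟩
      refine ⟨hm.trans hmm', ?_⟩
      have := OrderHomClass.mono (transition K hmm').hom hp
      rwa [transition_transition, transition_transition] at this)
    (by
      rintro m π p ⟨hm, hp⟩
      refine ⟨hm, ?_⟩
      simp only [Prod.smul_fst, Prod.smul_snd, (transition K hm).map_smul]
      exact (K.obj m).obj.nominal.smul_mono π hp)
    (by
      rintro ⟨_, _⟩ ⟨⟨x, hx, rfl⟩, rfl⟩
      have := hl ⟨x, hx, rfl⟩
      rwa [← mk_transition hin x, mk_le_mk] at this)
  obtain ⟨m, hm₀m, hnm⟩ := exists_ge_ge m₀ n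
  rw [← mk_transition hin s]
  refine mk_le_mk.2 ⟨m, hnm, ?_⟩
  have hlub := (transition K hnm).map_isLUB _ _ hX' ((transition K hin).map_isLUB X s hX hs)
  refine hlub.2 ?_
  rintro _ ⟨_, ⟨x, hx, rfl⟩, rfl⟩
  obtain ⟨h, hle⟩ := hm₀ (_, v') ⟨⟨x, hx, rfl⟩, rfl⟩
  have := OrderHomClass.mono (transition K hm₀m).hom hle
  exact (transition_transition K h hm₀m _).symm.trans_le
    (this.trans_eq (transition_transition K h hm₀m _))

variable (K) in
lemma isOFComplete : IsOFComplete 𝔸 (ColimCarrier K) := by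
  intro X hX
  obtain ⟨i, hi⟩ := hX.2.exists_uniform (fun i l => l ∈ Set.range (mk (K := K) i))
    (by
      rintro i j _ hij ⟨x, rfl⟩
      exact ⟨(transition K hij).hom x, mk_transition hij x⟩)
    (by
      rintro i π _ ⟨x, rfl⟩
      exact ⟨π • x, rfl⟩)
    fun l _ => by
      obtain ⟨i, x, hx⟩ := exists_mk l
      exact ⟨i, x, hx⟩
  obtain ⟨Y, hY, rfl⟩ := hX.exists_image_eq _ (mk_smul i) hi
  obtain ⟨s, hs⟩ := (K.obj i).obj.ofComplete Y hY
  exact ⟨_, isLUB_mk i hY hs⟩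

/-- The coprojections into the directed union. -/
noncomputable def coproj (i : J) : OFCHom 𝔸 (K.obj i).obj.carrier (ColimCarrier K) where
  hom :=
    { toFun := mk i
      map_sup' := mk_sup i
      map_inf' := mk_inf i
      map_top' := mk_top i
      map_bot' := mk_bot i }
  map_smul := mk_smul i
  map_isLUB _ _ := isLUB_mk i

variable (K) in
lemma isLocallyKAtomic : IsLocallyKAtomic 𝔸 k (ColimCarrier K) := by
  intro l
  obtain ⟨i, x, rfl⟩ := exists_mk l
  obtain ⟨A, hA, hx⟩ := (K.obj i).property x
  let incl : OFCHom 𝔸 A.toBooleanSubalgebra (K.obj i).obj.carrier :=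
    A.subtype (K.obj i).obj.ofComplete
  let f : OFCHom 𝔸 A.toBooleanSubalgebra (ColimCarrier K) :=
    { hom := (coproj i).hom.comp incl.hom
      map_smul := fun π y => ((congrArg _ (incl.map_smul π y)).trans ((coproj i).map_smul π _) :)
      map_isLUB := fun X s hX hs => by
        have := (coproj i).map_isLUB _ _ (hX.image _ incl.map_smul) (incl.map_isLUB X s hX hs)
        rwa [Set.image_image] at this }
  obtain ⟨S, hS, hfS⟩ := f.exists_isKAtomic_range_subset
    (A.isNominalBA (K.obj i).obj.nominal) hA (isNominalBA K)
  exact ⟨S, hS, hfS ⟨⟨x, hx⟩, rfl⟩⟩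

end ColimCarrier

variable [Nonempty J]

/-- The cocone with vertex the directed union. -/
noncomputable def unionCocone : Cocone K where
  pt := ⟨{ carrier := ColimCarrier K
           nominal := ColimCarrier.isNominalBA K
           ofComplete := ColimCarrier.isOFComplete K }, ColimCarrier.isLocallyKAtomic K⟩
  ι := { app := fun i => ObjectProperty.homMk (ColimCarrier.coproj i)
         naturality := fun _ _ h => toHom_ext fun x =>
          ColimCarrier.mk_transition (leOfHom h) x }

lemma isDirectedUnion_unionCocone : IsDirectedUnion (unionCocone K) where
  surj := ColimCarrier.exists_mk
  inj i x y h := by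
    obtain ⟨j, h₁, h₂, e⟩ := ColimCarrier.mk_eq_mk.1 h
    exact ⟨j, h₁, e⟩

end DirectedUnion

section Creation

variable (𝔸 : Type a) (k : ℕ)

lemma hasDirectedColimits_locKAtomic :
    HasDirectedColimits.{u} (LocKAtomicOFCBA.{a, u} 𝔸 k) := fun _ _ _ _ =>
  ⟨fun K => ⟨⟨_, (isDirectedUnion_unionCocone K).nonempty_isColimit.some⟩⟩⟩

lemma preservesDirectedColimits_forgetNom :
    PreservesDirectedColimits.{u} (forgetNom.{a, u} 𝔸 k) := fun _ _ _ _ =>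
  ⟨fun {K} => preservesColimit_of_preserves_colimit_cocone
    (isDirectedUnion_unionCocone K).nonempty_isColimit.some
    (isDirectedUnion_unionCocone K).nonempty_isColimit_forget.some⟩

/-- An equivariant bijection that is a morphism of algebras is invertible, being an order
isomorphism. -/
lemma isIso_of_bijective {𝔸 : Type a} {k : ℕ} {B C : LocKAtomicOFCBA.{a, u} 𝔸 k} (f : B ⟶ C)
    (hf : Function.Bijective (LocKAtomicOFCBA.toHom f).hom) : IsIso f := by
  let f' := LocKAtomicOFCBA.toHom f
  let e : B.obj.carrier ≃o C.obj.carrier :=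
    { Equiv.ofBijective f'.hom hf with
      map_rel_iff' := fun {x y} => by
        change f'.hom x ≤ f'.hom y ↔ x ≤ y
        rw [← sup_eq_right, ← map_sup, hf.1.eq_iff, sup_eq_right] }
  have he : ∀ x, f'.hom (e.symm x) = x := e.apply_symm_apply
  let g : OFCHom 𝔸 C.obj.carrier B.obj.carrier :=
    { hom := (e.symm : BoundedLatticeHom C.obj.carrier B.obj.carrier)
      map_smul := fun π x => hf.1 (by
        change f'.hom (e.symm _) = f'.hom (π • e.symm x)
        rw [f'.map_smul, he, he])
      map_isLUB := fun X s _ hs => e.symm.isLUB_image'.2 hs }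
  exact ⟨⟨ObjectProperty.homMk g, toHom_ext fun x => e.symm_apply_apply x, toHom_ext he⟩⟩

instance : (forgetNom.{a, u} 𝔸 k).ReflectsIsomorphisms where
  reflects {B C} f hf := by
    refine isIso_of_bijective f (Function.bijective_iff_has_inverse.2
      ⟨Nom.toMap (inv ((forgetNom.{a, u} 𝔸 k).map f)), fun x => ?_, fun x => ?_⟩)
    · exact Nom.toMap_congr (IsIso.hom_inv_id ((forgetNom.{a, u} 𝔸 k).map f)) x
    · exact Nom.toMap_congr (IsIso.inv_hom_id ((forgetNom.{a, u} 𝔸 k).map f)) x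

lemma createsDirectedColimits_forgetNom :
    CreatesDirectedColimits.{u} (forgetNom.{a, u} 𝔸 k) := fun J _ _ _ =>
  have := hasDirectedColimits_locKAtomic.{a, u} 𝔸 k J
  have := preservesDirectedColimits_forgetNom.{a, u} 𝔸 k J
  ⟨⟨createsColimitOfReflectsIsomorphismsOfPreserves⟩⟩

end Creation

/-! ### Finite presentability of `k`-atomic algebras -/

section FinitePresentability

open LocKAtomicOFCBA (toHom)

variable {𝔸 : Type a} {k : ℕ} {J : Type w} [Preorder J] [IsDirectedOrder J] [Nonempty J]
  {K : J ⥤ LocKAtomicOFCBA.{a, u} 𝔸 k} {c : Cocone K}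

/-- Two equivariant families in one stage that agree in the directed union agree at some later
stage, provided that the index set meets only finitely many orbits. -/
lemma IsDirectedUnion.exists_uniform_eq (hc : IsDirectedUnion c) {X : Type*}
    [MulAction (FinPerm 𝔸) X] {s : Set X} (hs : MeetsFinitelyManyOrbits 𝔸 s) {i : J}
    (p q : X → (K.obj i).obj.carrier) (hp : ∀ (π : FinPerm 𝔸) x, p (π • x) = π • p x)
    (hq : ∀ (π : FinPerm 𝔸) x, q (π • x) = π • q x)
    (h : ∀ x ∈ s, (leg c i).hom (p x) = (leg c i).hom (q x)) :
    ∃ (j : J) (hij : i ≤ j), ∀ x ∈ s, (transition K hij).hom (p x) = (transition K hij).hom (q x) := by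
  obtain ⟨j, hj⟩ := hs.exists_uniform
    (fun j x => ∃ hij : i ≤ j, (transition K hij).hom (p x) = (transition K hij).hom (q x))
    (by
      rintro j l x hjl ⟨hij, e⟩
      refine ⟨hij.trans hjl, ?_⟩
      rw [← transition_transition K hij hjl, ← transition_transition K hij hjl, e])
    (by
      rintro j π x ⟨hij, e⟩
      refine ⟨hij, ?_⟩
      rw [hp, hq, (transition K hij).map_smul, (transition K hij).map_smul, e])
    fun x hx => hc.inj i _ _ (h x hx)
  obtain ⟨l, hjl, hil⟩ := exists_ge_ge j i
  refine ⟨l, hil, fun x hx => ?_⟩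
  obtain ⟨hij, e⟩ := hj x hx
  rw [← transition_transition K hij hjl, ← transition_transition K hij hjl, e]

/-- An equivariant map from the atoms of a `k`-atomic algebra into a directed union lifts to an
equivariant map into some stage. Representatives of the finitely many orbits of atoms are lifted
arbitrarily; the pairs of candidates for the lift of one and the same atom form finitely many
orbits, hence the candidates agree at a later stage. -/
lemma IsDirectedUnion.exists_lift_atoms (hc : IsDirectedUnion c)
    {A : Type*} [BooleanAlgebra A] [MulAction (FinPerm 𝔸) A] (hA : IsNominalBA 𝔸 A)
    (h : IsKAtomic 𝔸 k A) (f : A → c.pt.obj.carrier)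
    (hf : ∀ (π : FinPerm 𝔸) x, f (π • x) = π • f x) :
    ∃ (i : J) (g : A → (K.obj i).obj.carrier), (∀ (π : FinPerm 𝔸) x, g (π • x) = π • g x) ∧
      ∀ b, IsAtom b → (leg c i).hom (g b) = f b := by
  classical
  obtain ⟨r, hrA, hr, hr'⟩ := h.atoms_orbits.exists_finite
  obtain ⟨i, hi⟩ := hc.exists_common_stage (h.atoms_orbits.image f hf)
  have hi' : ∀ b : A, ∃ d : (K.obj i).obj.carrier, IsAtom b → (leg c i).hom d = f b := fun b => by
    by_cases hb : IsAtom b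
    · obtain ⟨d, hd⟩ := hi ⟨b, hb, rfl⟩
      exact ⟨d, fun _ => hd⟩
    · exact ⟨⊥, fun hb' => absurd hb' hb⟩
  choose d hd using hi'
  choose! y hyr π hπ using hr'
  have horb : MeetsFinitelyManyOrbits 𝔸 {x | ∃ y ∈ r, ∃ σ : FinPerm 𝔸, σ • d y = x} :=
    .of_finite (hr.image d) (by
      rintro _ ⟨y, hy, σ, rfl⟩
      exact ⟨d y, ⟨y, hy, rfl⟩, σ, rfl⟩)
  have hpairs : MeetsFinitelyManyOrbits 𝔸 {p : (K.obj i).obj.carrier × (K.obj i).obj.carrier |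
      ∃ y ∈ r, ∃ y' ∈ r, ∃ σ σ' : FinPerm 𝔸, σ • y = σ' • y' ∧ p = (σ • d y, σ' • d y')} :=
    (horb.prod horb (fun x _ => (K.obj i).obj.nominal.finSupp x)
      fun x _ => (K.obj i).obj.nominal.finSupp x).mono (by
      rintro _ ⟨y, hy, y', hy', σ, σ', -, rfl⟩
      exact ⟨⟨y, hy, σ, rfl⟩, ⟨y', hy', σ', rfl⟩⟩)
  obtain ⟨j, hij, hj⟩ := hc.exists_uniform_eq hpairs Prod.fst Prod.snd (fun _ _ => rfl)
    (fun _ _ => rfl) (by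
      rintro _ ⟨y, hy, y', hy', σ, σ', e, rfl⟩
      simp only [(leg c i).map_smul, hd y (hrA hy), hd y' (hrA hy')]
      rw [← hf, ← hf, e])
  refine ⟨j, fun b => if IsAtom b then (transition K hij).hom (π b • d (y b)) else ⊥,
    fun σ b => ?_, fun b hb => ?_⟩
  · by_cases hb : IsAtom b
    · have hσb := hA.isAtom_smul σ hb
      simp only [if_pos hb, if_pos hσb]
      rw [← (transition K hij).map_smul, ← mul_smul]
      exact hj (_, _) ⟨_, hyr _ hσb, _, hyr _ hb, _, _, by rw [hπ _ hσb, mul_smul, hπ _ hb], rfl⟩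
    · have hσb : ¬ IsAtom (σ • b) := fun hσb => hb (by simpa using hA.isAtom_smul σ⁻¹ hσb)
      simp only [if_neg hb, if_neg hσb, (K.obj j).obj.nominal.smul_bot]
  · simp only [if_pos hb]
    rw [leg_transition, (leg c i).map_smul, hd _ (hrA (hyr _ hb)), ← hf, hπ _ hb]

variable {A : LocKAtomicOFCBA.{a, u} 𝔸 k}

lemma IsDirectedUnion.exists_lift (hc : IsDirectedUnion c) (hA : IsKAtomic 𝔸 k A.obj.carrier)
    (f : A ⟶ c.pt) : ∃ (i : J) (g : A ⟶ K.obj i), g ≫ c.ι.app i = f := by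
  have hN := A.obj.nominal
  obtain ⟨i, g, hg, hgf⟩ := hc.exists_lift_atoms hN hA (toHom f).hom (toHom f).map_smul
  -- the lifts of distinct atoms become disjoint
  obtain ⟨j, hij, hj⟩ := hc.exists_uniform_eq (i := i)
    (s := {p : A.obj.carrier × A.obj.carrier | IsAtom p.1 ∧ IsAtom p.2 ∧ p.1 ≠ p.2})
    ((hA.atoms_orbits.prod hA.atoms_orbits (fun x _ => hN.finSupp x)
      fun x _ => hN.finSupp x).mono fun p hp => ⟨hp.1, hp.2.1⟩)
    (fun p => g p.1 ⊓ g p.2) (fun _ => ⊥)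
    (fun π p => by
      rw [Prod.smul_fst, Prod.smul_snd, hg, hg, (K.obj i).obj.nominal.smul_inf])
    (fun π _ => ((K.obj i).obj.nominal.smul_bot π).symm)
    (by
      rintro ⟨b, b'⟩ ⟨hb, hb', hne⟩
      rw [map_inf, hgf b hb, hgf b' hb', ← map_inf, (hb.disjoint_of_ne hb' hne).eq_bot, map_bot,
        map_bot])
  -- the supremum of the lifts becomes the top element
  have hof := (hA.orbitFinite_atoms hN).image g hg
  obtain ⟨s, hs⟩ := (K.obj i).obj.ofComplete _ hof
  have hs_eq_top : (leg c i).hom s = (leg c i).hom ⊤ := by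
    have h₁ := (leg c i).map_isLUB _ _ hof hs
    rw [Set.image_image, Set.image_congr (s := {b | IsAtom b}) fun b hb => hgf b hb] at h₁
    have h₂ := (toHom f).map_isLUB _ _ (hA.orbitFinite_atoms hN) hA.isLUB_atoms_top
    rw [h₁.unique h₂, map_top, map_top]
  obtain ⟨l, hil, hl⟩ := hc.inj i _ _ hs_eq_top
  obtain ⟨m, hjm, hlm⟩ := exists_ge_ge j l
  have him := hij.trans hjm
  obtain ⟨e, he⟩ := hA.exists_hom_extending hN (K.obj m).obj.nominal (K.obj m).obj.ofComplete
    (fun x => (transition K him).hom (g x))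
    (fun π x => by rw [hg, (transition K him).map_smul])
    (fun b b' hb hb' hne => by
      rw [disjoint_iff, ← map_inf, ← transition_transition K hij hjm]
      rw [show (transition K hij).hom (g b ⊓ g b') = _ from hj (b, b') ⟨hb, hb', hne⟩, map_bot,
        map_bot])
    (by
      have h₁ := (transition K him).map_isLUB _ _ hof hs
      rwa [Set.image_image, ← transition_transition K hil hlm, hl, map_top, map_top] at h₁)
  refine ⟨m, ObjectProperty.homMk e, ?_⟩
  refine ObjectProperty.hom_ext _ (OFCHom.eq_of_eqOn_atoms hA hN fun b hb => ?_)
  change (leg c m).hom (e.hom b) = (toHom f).hom b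
  rw [he b hb, leg_transition, hgf b hb]

lemma IsDirectedUnion.exists_comp_eq (hc : IsDirectedUnion c) (hA : IsKAtomic 𝔸 k A.obj.carrier)
    {i : J} (f g : A ⟶ K.obj i) (hfg : f ≫ c.ι.app i = g ≫ c.ι.app i) :
    ∃ (j : J) (h : i ≤ j), f ≫ K.map (homOfLE h) = g ≫ K.map (homOfLE h) := by
  obtain ⟨j, hij, hj⟩ := hc.exists_uniform_eq hA.atoms_orbits (toHom f).hom (toHom g).hom
    (toHom f).map_smul (toHom g).map_smul fun b _ => by
      rw [← toHom_comp_apply, hfg, toHom_comp_apply]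
  exact ⟨j, hij, ObjectProperty.hom_ext _ (OFCHom.eq_of_eqOn_atoms hA A.obj.nominal hj)⟩

lemma isFinPresentable_of_isKAtomic (hA : IsKAtomic 𝔸 k A.obj.carrier) :
    IsFinPresentable.{u} A := fun J _ _ _ =>
  ⟨fun {K} => by
    have hc := isDirectedUnion_unionCocone K
    refine preservesColimit_of_preserves_colimit_cocone hc.nonempty_isColimit.some ?_
    refine Types.FilteredColimit.isColimitOf' _ _ (fun f => ?_) fun i f g hfg => ?_
    · obtain ⟨i, g, hg⟩ := hc.exists_lift hA f
      exact ⟨i, g, hg.symm⟩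
    · obtain ⟨j, h, e⟩ := hc.exists_comp_eq hA f g hfg
      exact ⟨j, homOfLE h, e⟩⟩

end FinitePresentability

/-! ### The diagram of `k`-atomic subalgebras -/

section KAtomicSubalgebras

variable {𝔸 : Type a} {k : ℕ}

lemma IsLocallyKAtomic.exists_isKAtomic {B : Type*} [BooleanAlgebra B] [MulAction (FinPerm 𝔸) B]
    (h : IsLocallyKAtomic 𝔸 k B) : ∃ A : Subalg 𝔸 B, IsKAtomic 𝔸 k A.toBooleanSubalgebra :=
  let ⟨A, hA, _⟩ := h ⊥
  ⟨A, hA⟩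

variable (B : LocKAtomicOFCBA.{a, u} 𝔸 k)

/-- The `k`-atomic subalgebras of an algebra, ordered by inclusion. -/
def KAtomicSubalg : Type u :=
  {A : Subalg 𝔸 B.obj.carrier // IsKAtomic 𝔸 k A.toBooleanSubalgebra}

instance : Preorder (KAtomicSubalg B) := Preorder.lift fun A => A.1.carrier

instance : Nonempty (KAtomicSubalg B) :=
  let ⟨A, hA⟩ := B.property.exists_isKAtomic
  ⟨⟨A, hA⟩⟩

instance : IsDirectedOrder (KAtomicSubalg B) where
  directed A₁ A₂ :=
    let ⟨A, hA, h₁, h₂⟩ :=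
      B.property.exists_isKAtomic_superset B.obj.nominal B.obj.ofComplete A₁.2 A₂.2
    ⟨⟨A, hA⟩, h₁, h₂⟩

variable {B}

/-- The inclusion between two subalgebras. -/
def Subalg.inclusion {B : Type*} [BooleanAlgebra B] [MulAction (FinPerm 𝔸) B]
    (hc : IsOFComplete 𝔸 B) {A₁ A₂ : Subalg 𝔸 B} (h : A₁.carrier ⊆ A₂.carrier) :
    OFCHom 𝔸 A₁.toBooleanSubalgebra A₂.toBooleanSubalgebra where
  hom :=
    { toFun := fun x => ⟨x.1, h x.2⟩
      map_sup' := fun _ _ => rfl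
      map_inf' := fun _ _ => rfl
      map_top' := rfl
      map_bot' := rfl }
  map_smul _ _ := rfl
  map_isLUB X s hX hs := A₂.isLUB_of_isLUB_val (by
    rw [Set.image_image]
    exact (A₁.subtype hc).map_isLUB X s hX hs)

/-- A `k`-atomic subalgebra as a `k`-atomic complete algebra. -/
def KAtomicSubalg.toKAtomicCBA (A : KAtomicSubalg B) : KAtomicCBA.{a, u} 𝔸 k :=
  ⟨{ carrier := A.1.toBooleanSubalgebra
     nominal := A.1.isNominalBA B.obj.nominal
     complete := A.2.isComplete (A.1.isNominalBA B.obj.nominal)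
      (A.1.isOFComplete B.obj.ofComplete) }, A.2⟩

/-- A homomorphism of orbit-finitely complete algebras out of a `k`-atomic algebra is a
homomorphism of complete algebras. -/
def OFCHom.toCHom {B C : Type*} [BooleanAlgebra B] [MulAction (FinPerm 𝔸) B] [BooleanAlgebra C]
    [MulAction (FinPerm 𝔸) C] (f : OFCHom 𝔸 B C) (h : IsKAtomic 𝔸 k B) (hB : IsNominalBA 𝔸 B) :
    CHom 𝔸 B C where
  hom := f.hom
  map_smul := f.map_smul
  map_isLUB _ _ hX hs := f.map_isLUB_of_finSupp h hB hX hs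

variable (B)

/-- The diagram of the `k`-atomic subalgebras. -/
def subalgDiagram : KAtomicSubalg B ⥤ KAtomicCBA.{a, u} 𝔸 k where
  obj A := A.toKAtomicCBA
  map {A₁ A₂} h := ObjectProperty.homMk
    ((Subalg.inclusion B.obj.ofComplete (leOfHom h)).toCHom A₁.2
      (A₁.1.isNominalBA B.obj.nominal) : CHom 𝔸 A₁.1.toBooleanSubalgebra A₂.1.toBooleanSubalgebra)
  map_id _ := rfl
  map_comp _ _ := rfl

/-- The cocone of all inclusions of `k`-atomic subalgebras. -/
def subalgCocone : Cocone (subalgDiagram B ⋙ inclusion.{a, u} 𝔸 k) where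
  pt := B
  ι := { app := fun A => ObjectProperty.homMk (A.1.subtype B.obj.ofComplete)
         naturality := fun _ _ _ => rfl }

lemma isDirectedUnion_subalgCocone : IsDirectedUnion (subalgCocone B) where
  surj x := by
    obtain ⟨A, hA, hx⟩ := B.property x
    exact ⟨⟨A, hA⟩, ⟨x, hx⟩, rfl⟩
  inj A x y h := ⟨A, le_rfl, by rw [show x = y from Subtype.ext h]⟩

end KAtomicSubalgebras

/-! ### The inclusion functor -/

section Inclusion

variable (𝔸 : Type a) (k : ℕ)

instance : (inclusion.{a, u} 𝔸 k).Full where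
  map_surjective {A _} f :=
    ⟨ObjectProperty.homMk ((LocKAtomicOFCBA.toHom f).toCHom A.property A.obj.nominal), rfl⟩

instance : (inclusion.{a, u} 𝔸 k).Faithful where
  map_injective {_ _} f g h := by
    have : f.hom.hom = g.hom.hom := congrArg (fun f => (LocKAtomicOFCBA.toHom f).hom) h
    exact ObjectProperty.hom_ext _ (CHom.ext this)

lemma inclusion_obj_injective : Function.Injective (inclusion.{a, u} 𝔸 k).obj := by
  rintro ⟨⟨A, hA, hA'⟩, hA''⟩ ⟨⟨B, hB, hB'⟩, hB''⟩ h
  cases h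
  rfl

end Inclusion

/-! ### Recognising Ind-completions -/

section RecognisingIndCompletions

variable {C : Type u₁} [Category.{v₁} C] {D : Type u₂} [Category.{v₂} D]
  {T : Type u₃} [Category.{v₃} T]

section Factorization

variable {J : Type w} [Preorder J] [IsDirectedOrder J] [Nonempty J] {X : D}

lemma IsFinPresentable.exists_lift (hX : IsFinPresentable.{w} X) {K : J ⥤ D} {c : Cocone K}
    (hc : IsColimit c) (f : X ⟶ c.pt) : ∃ (j : J) (g : X ⟶ K.obj j), g ≫ c.ι.app j = f := by
  have := hX J
  obtain ⟨j, g, hg⟩ := Types.jointly_surjective_of_isColimit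
    (isColimitOfPreserves (coyoneda.obj (Opposite.op X)) hc) f
  exact ⟨j, g, hg⟩

lemma IsFinPresentable.exists_comp_eq (hX : IsFinPresentable.{w} X) {K : J ⥤ D} {c : Cocone K}
    (hc : IsColimit c) {i : J} (f g : X ⟶ K.obj i) (h : f ≫ c.ι.app i = g ≫ c.ι.app i) :
    ∃ (j : J) (hij : i ⟶ j), f ≫ K.map hij = g ≫ K.map hij := by
  have := hX J
  exact (Types.FilteredColimit.isColimit_eq_iff'
    (isColimitOfPreserves (coyoneda.obj (Opposite.op X)) hc) f g).1 h

end Factorization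

/-- Every object of `D` is the colimit of a directed diagram of objects in the image of `E`. -/
def IsDirectedColimitDense (E : C ⥤ D) : Prop :=
  ∀ B : D, ∃ (J : Type w) (_ : Preorder J) (_ : IsDirectedOrder J) (_ : Nonempty J) (K : J ⥤ C)
    (ι : K ⋙ E ⟶ (Functor.const J).obj B), Nonempty (IsColimit (Cocone.mk B ι))

section KanExtension

variable {E : C ⥤ D}

/-- A cocone from a diagram of `E`-objects as a diagram in the category of `E`-objects over its
vertex. -/
abbrev overDiagram {J : Type w} [Preorder J] {B : D} (K : J ⥤ C)
    (ι : K ⋙ E ⟶ (Functor.const J).obj B) : J ⥤ CostructuredArrow E B :=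
  K.toCostructuredArrow E B (fun j => ι.app j) fun f => (ι.naturality f).trans (Category.comp_id _)

/-- If the `E`-objects are finitely presentable, a directed colimit of `E`-objects with vertex `B`
is final among all `E`-objects over `B`. -/
lemma final_overDiagram [E.Full] [E.Faithful] (hfp : ∀ X, IsFinPresentable.{w} (E.obj X))
    {J : Type w} [Preorder J] [IsDirectedOrder J] [Nonempty J] {B : D} {K : J ⥤ C}
    {ι : K ⋙ E ⟶ (Functor.const J).obj B} (hι : IsColimit (Cocone.mk B ι)) :
    (overDiagram K ι).Final := by
  refine Functor.final_of_exists_of_isFiltered _ (fun d => ?_) fun {d j} s s' => ?_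
  · obtain ⟨j, g, hg⟩ := (hfp d.left).exists_lift hι d.hom
    obtain ⟨g, rfl⟩ := E.map_surjective g
    exact ⟨j, ⟨CostructuredArrow.homMk g hg⟩⟩
  · obtain ⟨l, t, ht⟩ := (hfp d.left).exists_comp_eq hι (E.map s.left) (E.map s'.left)
      ((CostructuredArrow.w s).trans (CostructuredArrow.w s').symm)
    refine ⟨l, t, CostructuredArrow.hom_ext _ _ (E.map_injective ?_)⟩
    exact (E.map_comp _ _).trans (ht.trans (E.map_comp _ _).symm)

lemma hasPointwiseLeftKanExtension_of_dense [E.Full] [E.Faithful]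
    (hfp : ∀ X, IsFinPresentable.{w} (E.obj X)) (hE : IsDirectedColimitDense.{w} E)
    (hT : HasDirectedColimits.{w} T) (F : C ⥤ T) : E.HasPointwiseLeftKanExtension F := by
  intro B
  obtain ⟨J, _, _, _, K, ι, ⟨hι⟩⟩ := hE B
  have := hT J
  have := final_overDiagram hfp hι
  exact Functor.Final.hasColimit_of_comp (overDiagram K ι)

/-- A functor preserving directed colimits is the left Kan extension of its restriction. -/
lemma isLeftKanExtension_of_preservesDirectedColimits [E.Full] [E.Faithful]
    (hfp : ∀ X, IsFinPresentable.{w} (E.obj X)) (hE : IsDirectedColimitDense.{w} E)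
    {G : D ⥤ T} (hG : PreservesDirectedColimits.{w} G) :
    G.IsLeftKanExtension (𝟙 (E ⋙ G)) := by
  refine Functor.LeftExtension.IsPointwiseLeftKanExtension.isLeftKanExtension
    (E := Functor.LeftExtension.mk G (𝟙 (E ⋙ G))) fun B => ?_
  have : Nonempty (IsColimit
      ((Functor.LeftExtension.mk G (𝟙 (E ⋙ G))).coconeAt B)) := by
    obtain ⟨J, _, _, _, K, ι, ⟨hι⟩⟩ := hE B
    have := hG J
    have := final_overDiagram hfp hι
    refine ⟨(Functor.Final.isColimitWhiskerEquiv (overDiagram K ι) _) ?_⟩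
    refine IsColimit.ofIsoColimit (isColimitOfPreserves G hι)
      (Cocone.ext (Iso.refl _) fun j => ?_)
    change G.map (ι.app j) ≫ 𝟙 _ = 𝟙 _ ≫ G.map (ι.app j)
    rw [Category.comp_id, Category.id_comp]
  exact this.some

/-- The pointwise left Kan extension along a functor `E` with finitely presentable values preserves
directed colimits: a morphism from an `E`-object into a directed colimit factors through a stage,
in an essentially unique way. -/
lemma preservesDirectedColimits_of_pointwise (hfp : ∀ X, IsFinPresentable.{w} (E.obj X))
    {F : C ⥤ T} (G : D ⥤ T) (α : F ⟶ E ⋙ G)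
    (hG : (Functor.LeftExtension.mk G α).IsPointwiseLeftKanExtension) :
    PreservesDirectedColimits.{w} G := by
  intro J _ _ _
  refine ⟨fun {K} => ⟨fun {c} hc => ?_⟩⟩
  -- the universal property of `G.obj B` as a colimit over all morphisms from `E`-objects to `B`
  have hext : ∀ {B : D} {t : T} {f g : G.obj B ⟶ t},
      (∀ (A : C) (p : E.obj A ⟶ B), α.app A ≫ G.map p ≫ f = α.app A ≫ G.map p ≫ g) → f = g :=
    fun {B t f g} h => (hG B).hom_ext fun p =>
      (Category.assoc (α.app p.left) (G.map p.hom) f).trans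
        ((h p.left p.hom).trans (Category.assoc (α.app p.left) (G.map p.hom) g).symm)
  have hdesc : ∀ (B : D) (t : T) (s : ∀ A : C, (E.obj A ⟶ B) → (F.obj A ⟶ t)),
      (∀ {A A' : C} (h : A ⟶ A') (p : E.obj A' ⟶ B), F.map h ≫ s A' p = s A (E.map h ≫ p)) →
      ∃ d : G.obj B ⟶ t, ∀ A p, α.app A ≫ G.map p ≫ d = s A p := fun B t s hs => by
    let S : Cocone (CostructuredArrow.proj E B ⋙ F) :=
      { pt := t
        ι :=
          { app := fun p => s p.left p.hom
            naturality := fun p p' φ => by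
              have := hs φ.left p'.hom
              rw [CostructuredArrow.w] at this
              exact this.trans (Category.comp_id _).symm } }
    exact ⟨(hG B).desc S, fun A p => (Category.assoc (α.app A) (G.map p) _).symm.trans
      ((hG B).fac S (CostructuredArrow.mk p))⟩
  have hlift : ∀ (A : C) (p : E.obj A ⟶ c.pt), ∃ (j : J) (g : E.obj A ⟶ K.obj j),
      g ≫ c.ι.app j = p := fun A p => (hfp A).exists_lift hc p
  choose j g hg using hlift
  have hindep : ∀ (s : Cocone (K ⋙ G)) {A : C} {i i' : J} (q : E.obj A ⟶ K.obj i)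
      (q' : E.obj A ⟶ K.obj i'), q ≫ c.ι.app i = q' ≫ c.ι.app i' →
      G.map q ≫ s.ι.app i = G.map q' ≫ s.ι.app i' := by
    intro s A i i' q q' e
    obtain ⟨m, him, him'⟩ := exists_ge_ge i i'
    obtain ⟨n, t, ht⟩ := (hfp A).exists_comp_eq hc (q ≫ K.map (homOfLE him))
      (q' ≫ K.map (homOfLE him')) (by simpa using e)
    have hw : ∀ {i : J} (q : E.obj A ⟶ K.obj i) (h : i ≤ m),
        G.map q ≫ s.ι.app i = G.map ((q ≫ K.map (homOfLE h)) ≫ K.map t) ≫ s.ι.app n := by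
      intro i q h
      rw [← s.w (homOfLE h), ← s.w t]
      simp
    rw [hw q him, hw q' him', ht]
  have hex : ∀ s : Cocone (K ⋙ G), ∃ d : G.obj c.pt ⟶ s.pt, ∀ {A : C} (p : E.obj A ⟶ c.pt) {i : J}
      (q : E.obj A ⟶ K.obj i), q ≫ c.ι.app i = p →
      α.app A ≫ G.map p ≫ d = α.app A ≫ G.map q ≫ s.ι.app i := by
    intro s
    obtain ⟨d, hd⟩ := hdesc c.pt s.pt (fun A p => α.app A ≫ G.map (g A p) ≫ s.ι.app (j A p))
      (fun {A A'} h p => by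
        have h₁ := α.naturality h
        have h₂ := hindep s (g A (E.map h ≫ p)) (E.map h ≫ g A' p) (by simp [hg])
        simp only [Functor.comp_map] at h₁
        rw [h₂, reassoc_of% h₁, Functor.map_comp_assoc])
    refine ⟨d, fun {A} p {i} q e => ?_⟩
    rw [hd, hindep s (g A p) q ((hg A p).trans e.symm)]
  choose d hd using hex
  refine ⟨{ desc := d
            fac := fun s i => hext fun A q => ?_
            uniq := fun s m hm => hext fun A p => ?_ }⟩
  · rw [← hd s _ q rfl, Functor.map_comp_assoc]
    rfl
  · have hp := hg A p
    rw [hd s p _ hp, ← hm]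
    conv_lhs => rw [← hp, Functor.map_comp_assoc]
    rfl

end KanExtension

section Strictification

/-- An extension up to isomorphism along a functor that is injective on objects can be replaced by
an isomorphic functor that is an extension on the nose. -/
lemma exists_iso_comp_eq {E : C ⥤ D} (hE : Function.Injective E.obj) {F : C ⥤ T} (G : D ⥤ T)
    (e : E ⋙ G ≅ F) : ∃ G' : D ⥤ T, Nonempty (G ≅ G') ∧ E ⋙ G' = F := by
  -- the new values, together with the isomorphisms from the old ones
  have hex : ∀ B : D, ∃ p : (Σ' Y : T, G.obj B ≅ Y),
      ∀ (A : C) (h : E.obj A = B), p = ⟨F.obj A, G.mapIso (eqToIso h.symm) ≪≫ e.app A⟩ := by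
    intro B
    by_cases hB : ∃ A, E.obj A = B
    · obtain ⟨A, rfl⟩ := hB
      refine ⟨⟨F.obj A, e.app A⟩, fun A' h => ?_⟩
      obtain rfl := hE h
      simp
    · exact ⟨⟨G.obj B, Iso.refl _⟩, fun A h => absurd ⟨A, h⟩ hB⟩
  choose p hp using hex
  have hp' : ∀ A, p (E.obj A) = ⟨F.obj A, e.app A⟩ := fun A => by
    rw [hp _ A rfl]
    simp
  have hhom : ∀ {X : T} {q q' : Σ' Y : T, X ≅ Y} (h : q = q'),
      q.2.hom = q'.2.hom ≫ eqToHom (by rw [h]) := by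
    rintro X q _ rfl
    simp
  have hinv : ∀ {X : T} {q q' : Σ' Y : T, X ≅ Y} (h : q = q'),
      q.2.inv = eqToHom (by rw [h]) ≫ q'.2.inv := by
    rintro X q _ rfl
    simp
  refine ⟨G.copyObj (fun B => (p B).1) fun B => (p B).2, ⟨G.isoCopyObj _ _⟩,
    CategoryTheory.Functor.ext (fun A => congrArg PSigma.fst (hp' A)) fun A A' f => ?_⟩
  change (p (E.obj A)).2.inv ≫ G.map (E.map f) ≫ (p (E.obj A')).2.hom = _
  rw [hhom (hp' A'), hinv (hp' A)]
  have := e.hom.naturality f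
  simp only [Functor.comp_map] at this
  change _ = eqToHom _ ≫ F.map f ≫ eqToHom _
  simp [reassoc_of% this]

end Strictification

/-- A full embedding with finitely presentable values whose directed colimits exhaust the
codomain is an Ind-completion. Extensions are left Kan extensions. -/
theorem isIndCompletion_of_finPresentable (E : C ⥤ D) [E.Full] [E.Faithful]
    (hinj : Function.Injective E.obj) (hD : HasDirectedColimits.{w} D)
    (hfp : ∀ X, IsFinPresentable.{w} (E.obj X)) (hE : IsDirectedColimitDense.{w} E) :
    IsIndCompletion.{w, v₁, u₁, v₂, u₂, v₃, u₃} E where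
  full := inferInstance
  faithful := inferInstance
  injective_obj := hinj
  hasDirectedColimits := hD
  exists_extension {T} _ hT F := by
    have := hasPointwiseLeftKanExtension_of_dense hfp hE hT F
    have hL := E.pointwiseLeftKanExtensionIsPointwiseLeftKanExtension F
    have : IsIso (E.pointwiseLeftKanExtensionUnit F) := hL.isIso_hom
    obtain ⟨G, ⟨i⟩, hG⟩ := exists_iso_comp_eq hinj (E.pointwiseLeftKanExtension F)
      (asIso (E.pointwiseLeftKanExtensionUnit F)).symm
    refine ⟨G, fun J _ _ _ => ?_, hG⟩
    have := preservesDirectedColimits_of_pointwise hfp _ _ hL J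
    exact preservesColimitsOfShape_of_natIso i
  extension_unique {T} _ _ F G H hG hH eG eH := by
    have := isLeftKanExtension_of_preservesDirectedColimits hfp hE hG
    have := isLeftKanExtension_of_preservesDirectedColimits hfp hE hH
    refine ⟨Functor.leftKanExtensionUniqueOfIso G (𝟙 (E ⋙ G)) (eqToIso (eG.trans eH.symm)) H
      (𝟙 (E ⋙ H)), ?_⟩
    ext1
    have := G.descOfIsLeftKanExtension_fac (𝟙 (E ⋙ G)) H
      ((eqToIso (eG.trans eH.symm)).hom ≫ 𝟙 (E ⋙ H))
    rw [Category.id_comp, Category.comp_id] at this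
    simpa using this

end RecognisingIndCompletions

/-! ### `k`-atomic algebras inside locally `k`-atomic ones -/

lemma isDirectedColimitDense_inclusion (𝔸 : Type a) (k : ℕ) :
    IsDirectedColimitDense.{u} (inclusion.{a, u} 𝔸 k) := fun B =>
  ⟨KAtomicSubalg B, inferInstance, inferInstance, inferInstance, subalgDiagram B,
    (subalgCocone B).ι, (isDirectedUnion_subalgCocone B).nonempty_isColimit⟩

end NomBA

theorem mainTheorem3 (𝔸 : Type a) [Countable 𝔸] [Infinite 𝔸] (k : ℕ) :
    NomBA.IsIndCompletion.{u, u, max a (u + 1), u, max a (u + 1), v₃, u₃}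
      (NomBA.inclusion.{a, u} 𝔸 k) ∧
    NomBA.CreatesDirectedColimits.{u} (NomBA.forgetNom.{a, u} 𝔸 k) ∧
    NomBA.PreservesDirectedColimits.{u} (NomBA.forgetNom.{a, u} 𝔸 k) ∧
    (∀ A : NomBA.KAtomicCBA.{a, u} 𝔸 k,
      NomBA.IsFinPresentable.{u} ((NomBA.inclusion.{a, u} 𝔸 k).obj A)) ∧
    (∀ B : NomBA.LocKAtomicOFCBA.{a, u} 𝔸 k,
      (∃ A : NomBA.Subalg 𝔸 B.obj.carrier, NomBA.IsKAtomic 𝔸 k A.toBooleanSubalgebra) ∧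
      (∀ A₁ A₂ : NomBA.Subalg 𝔸 B.obj.carrier,
        NomBA.IsKAtomic 𝔸 k A₁.toBooleanSubalgebra →
        NomBA.IsKAtomic 𝔸 k A₂.toBooleanSubalgebra →
        ∃ A : NomBA.Subalg 𝔸 B.obj.carrier, NomBA.IsKAtomic 𝔸 k A.toBooleanSubalgebra ∧
          A₁.carrier ⊆ A.carrier ∧ A₂.carrier ⊆ A.carrier) ∧
      (⋃ A ∈ {A : NomBA.Subalg 𝔸 B.obj.carrier | NomBA.IsKAtomic 𝔸 k A.toBooleanSubalgebra},
        A.carrier) = Set.univ) := by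
  have hfp : ∀ A : NomBA.KAtomicCBA.{a, u} 𝔸 k,
      NomBA.IsFinPresentable.{u} ((NomBA.inclusion.{a, u} 𝔸 k).obj A) :=
    fun A => NomBA.isFinPresentable_of_isKAtomic A.property
  refine ⟨NomBA.isIndCompletion_of_finPresentable _ (NomBA.inclusion_obj_injective 𝔸 k)
      (NomBA.hasDirectedColimits_locKAtomic 𝔸 k) hfp (NomBA.isDirectedColimitDense_inclusion 𝔸 k),
    NomBA.createsDirectedColimits_forgetNom 𝔸 k, NomBA.preservesDirectedColimits_forgetNom 𝔸 k,
    hfp, fun B => ⟨B.property.exists_isKAtomic, fun A₁ A₂ h₁ h₂ =>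
      B.property.exists_isKAtomic_superset B.obj.nominal B.obj.ofComplete h₁ h₂,
      Set.eq_univ_of_forall fun x => ?_⟩⟩
  obtain ⟨A, hA, hx⟩ := B.property x
  exact Set.mem_biUnion hA hx
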